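/- Let $\kappa>0$, $0<\alpha<\pi/2$, $V_0>0$, and let $\beta:\mathbb R\to\mathbb R$ be Lipschitz continuous. For $v\in H^1_0(a,b)$, represented by its continuous representative and extended by $0$ to $\mathbb R$, put $$\mathcal F(v)=\int_{\mathbb R}\tfrac12|v_x|^2+\tfrac12 v^2\,\kappa\cos\alpha-v\,x\,\kappa\sin\alpha\;dx .$$ Call $u$ an obstacle minimizer on $(a,b)$ if it minimizes $\mathcal F$ over $\{v\in H^1_0(a,b):\ v\ge 0,\ \int v\,dx=V_0\}$. Let $u_0$ be an obstacle minimizer on $(a_0,b_0)$ with $\{u_0>0\}=(a_0,b_0)$. A function $u(x,t)$, $x\in\mathbb R$, $t\ge0$, is called a solution with initial data $u_0$ if there are functions $a(t),b(t)$, $t\ge 0$, Lipschitz on every bounded time interval $[0,T]$, with $a(0)=a_0$, $b(0)=b_0$, such that for all $t\ge0$ one has $\{x:u(x,t)>0\}=(a(t),b(t))$ and $u(\cdot,t)$ is an obstacle minimizer on $(a(t),b(t))$, and such that for almost every $t\ge0$ $$\min\{a'(t)+\tfrac12|u_x(a(t),t)|^2-\beta(a(t)),\ |u_x(a(t),t)|\}=0,$$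 $$\min\{-b'(t)+\tfrac12|u_x(b(t),t)|^2-\beta(b(t)),\ |u_x(b(t),t)|\}=0,$$ where $u_x$ at the endpoints denotes the one-sided derivative from inside $(a(t),b(t))$. Then there exists a unique solution $u$ with initial data $u_0$; its endpoints $a,b$ are also unique, and $u(\cdot,0)=u_0$. If moreover $\beta$ is bounded below (in particular if $\beta\ge0$), then $a$ and $b$ are Lipschitz on all of $[0,\infty)$. -/

import Mathlib

open MeasureTheory Set

noncomputable section

/-- The Sobolev space `H¹₀(a, b)`, each class being represented by its continuous representative,
extended by zero to the whole line: `v` vanishes off `(a, b)`, is absolutely continuous on `[a, b]`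
(hence differentiable almost everywhere, `deriv v` being then its weak derivative), and its
derivative is square integrable. -/
structure MemH10 (a b : ℝ) (v : ℝ → ℝ) : Prop where
  eq_zero : ∀ x, x ∉ Ioo a b → v x = 0
  absCont : AbsolutelyContinuousOnInterval v a b
  memLp_deriv : MemLp (deriv v) 2 volume

/-- The energy `𝓕(v) = ∫ ½ |v_x|² + ½ v² κ cos α - v x κ sin α dx` of a drop with profile `v`. -/
def dropEnergy (κ α : ℝ) (v : ℝ → ℝ) : ℝ :=
  ∫ x, (1 / 2 * (deriv v x) ^ 2 + (v x) ^ 2 / 2 * κ * Real.cos α - v x * x * κ * Real.sin α)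

/-- The admissible profiles: `v ∈ H¹₀(a, b)`, `v ≥ 0`, `∫ v = V₀`. -/
def admissibleDrops (V₀ a b : ℝ) : Set (ℝ → ℝ) :=
  {v | MemH10 a b v ∧ (∀ x, 0 ≤ v x) ∧ ∫ x, v x = V₀}

/-- `u` is a minimizer of the energy among the admissible profiles on `(a, b)`. -/
def IsObstacleMinimizer (κ α V₀ a b : ℝ) (u : ℝ → ℝ) : Prop :=
  u ∈ admissibleDrops V₀ a b ∧ IsMinOn (dropEnergy κ α) (admissibleDrops V₀ a b) u

/-- `u₀` is an initial drop with support `(a₀, b₀)`. -/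
def IsInitialDrop (κ α V₀ a₀ b₀ : ℝ) (u₀ : ℝ → ℝ) : Prop :=
  {x | 0 < u₀ x} = Ioo a₀ b₀ ∧ IsObstacleMinimizer κ α V₀ a₀ b₀ u₀

/-- `u` (a function of position `x` and time `t`), with endpoints `a` and `b`, is a solution of the
quasi-static sliding-drop problem that starts from the interval `(a₀, b₀)`. The slopes at the
endpoints are the one-sided derivatives from inside the drop. -/
structure IsSlidingDrop (κ α V₀ : ℝ) (β : ℝ → ℝ) (a₀ b₀ : ℝ) (a b : ℝ → ℝ) (u : ℝ → ℝ → ℝ) :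
    Prop where
  lipschitz_left : ∀ T, ∃ K, LipschitzOnWith K a (Icc 0 T)
  lipschitz_right : ∀ T, ∃ K, LipschitzOnWith K b (Icc 0 T)
  left_zero : a 0 = a₀
  right_zero : b 0 = b₀
  pos_set : ∀ t, 0 ≤ t → {x | 0 < u x t} = Ioo (a t) (b t)
  minimizer : ∀ t, 0 ≤ t → IsObstacleMinimizer κ α V₀ (a t) (b t) (fun x => u x t)
  velocity_left : ∀ᵐ t ∂(volume.restrict (Ici (0 : ℝ))),
    min (deriv a t + 1 / 2 * |derivWithin (fun x => u x t) (Icc (a t) (b t)) (a t)| ^ 2 - β (a t))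
      |derivWithin (fun x => u x t) (Icc (a t) (b t)) (a t)| = 0
  velocity_right : ∀ᵐ t ∂(volume.restrict (Ici (0 : ℝ))),
    min (-deriv b t + 1 / 2 * |derivWithin (fun x => u x t) (Icc (a t) (b t)) (b t)| ^ 2 - β (b t))
      |derivWithin (fun x => u x t) (Icc (a t) (b t)) (b t)| = 0

end

/-!
The problem is reduced to a planar differential equation for the endpoints, because the obstacle
minimizers are explicit.

Write `κ cos α = k²` and `κ sin α = k² D`. On `(a, b)` the Euler-Lagrange equation
`-p'' + k² p - k² D x = const` with zero boundary values and volume `V` has one solution, the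
`dropProfile`. Its inward slopes at the two ends are `C / g - D g` and `C / g + D g`, where
`C = V k² / 2`, `g = z coth z - 1` and `z = k (b - a) / 2` (`cothGap`). As `g` increases from `0` to
`∞`, the left slope is nonnegative exactly up to a maximal length `L`, and then the profile is
positive. Integration by parts (`dropEnergy_add_le`) shows that a competitor has an energy larger by
at least a multiple of its squared `L²` distance from the profile; on an interval longer than `L`
the same holds for the profile on the last piece of length `L`, which leaves zero tangentially. So
an obstacle minimizer is unique, and one with positivity set `(a, b)` exists if and only if
`0 < b - a ≤ L` (`isObstacleMinimizer_iff_of_le`, `IsObstacleMinimizer.length_mem`).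

With `e = (C / g)² + (D g)²`, the squared slopes are `e ± 2 C D`, and the velocity laws become, for
the length `l = b - a`,
`b' = e / 2 + C D - β b` and `l' ≤ e - β b - β (b - l)`, with equality where `l < L`
(`IsSlidingDrop.isDropFlow`, `isSlidingDrop_of_isDropFlow`). This is a differential equation
reflected at `l = L`, along the normal in the coordinates `(b, l)`.

* Uniqueness (`IsDropFlow.unique`): reflection along the normal of a convex constraint does not
  increase distances, so the Gronwall inequality applies.
* Existence (`exists_isDropFlow`): the reflection is the running maximum of the excess over `L`, a
  Lipschitz functional of the path, so the Picard operator is a contraction in a weighted norm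
  (`exists_reflected_solution`). As `e` blows up for short drops while `β` grows at most linearly
  and the midpoint moves at a controlled speed, the length stays away from zero on bounded time
  intervals.
* Global Lipschitz bound (`IsDropFlow.exists_lipschitzOnWith_Ici`): if `β` is bounded below, the
  midpoint has bounded speed, and a barrier argument, using that `e` decreases, bounds the speed of
  the length.
-/

/-! ### Comparison principles for absolutely continuous functions -/

/-- An absolutely continuous function with almost everywhere nonnegative derivative increases. -/
theorem AbsolutelyContinuousOnInterval.le_of_ae_deriv_nonneg {f : ℝ → ℝ} {a b : ℝ} (hab : a ≤ b)
    (hf : AbsolutelyContinuousOnInterval f a b)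
    (h : ∀ᵐ t, t ∈ Ioo a b → 0 ≤ deriv f t) : f a ≤ f b := by
  have h1 : 0 ≤ ∫ t in a..b, deriv f t := by
    apply intervalIntegral.integral_nonneg_of_ae_restrict hab
    rw [Filter.EventuallyLE, ← Measure.restrict_congr_set Ioo_ae_eq_Icc,
      ae_restrict_iff' measurableSet_Ioo]
    exact h
  rw [hf.integral_deriv_eq_sub] at h1
  linarith

theorem LipschitzOnWith.absolutelyContinuousOnInterval_of_le {f : ℝ → ℝ} {K : NNReal} {a b : ℝ}
    (hab : a ≤ b) (hf : LipschitzOnWith K f (Icc a b)) : AbsolutelyContinuousOnInterval f a b :=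
  LipschitzOnWith.absolutelyContinuousOnInterval (K := K) (by rwa [uIcc_of_le hab])

theorem AbsolutelyContinuousOnInterval.ae_differentiableAt_Ioo {f : ℝ → ℝ} {a b : ℝ}
    (hf : AbsolutelyContinuousOnInterval f a b) :
    ∀ᵐ t, t ∈ Ioo a b → DifferentiableAt ℝ f t := by
  filter_upwards [hf.ae_differentiableAt] with t ht hmem
  exact ht (Icc_subset_uIcc (Ioo_subset_Icc_self hmem))

/-- A barrier: an absolutely continuous function which starts above `c` and does not decrease while
it lies below `c` stays above `c`. -/
theorem AbsolutelyContinuousOnInterval.barrier {f : ℝ → ℝ} {T c : ℝ}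
    (hf : AbsolutelyContinuousOnInterval f 0 T) (h0 : c ≤ f 0)
    (h : ∀ᵐ t, t ∈ Ioo 0 T → f t < c → 0 ≤ deriv f t) : ∀ t ∈ Icc 0 T, c ≤ f t := by
  intro t ht
  by_contra! hlt
  have hT : (0 : ℝ) ≤ T := ht.1.trans ht.2
  have hcont : ContinuousOn f (Icc 0 t) := by
    have := hf.continuousOn
    rw [uIcc_of_le hT] at this
    exact this.mono (Icc_subset_Icc_right ht.2)
  -- the last time before `t` at which the function is at least `c`
  obtain ⟨r, hr, hmax⟩ : ∃ r ∈ Icc 0 t ∩ f ⁻¹' Ici c, ∀ r' ∈ Icc 0 t ∩ f ⁻¹' Ici c, r' ≤ r := by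
    have hcomp : IsCompact (Icc 0 t ∩ f ⁻¹' Ici c) :=
      isCompact_Icc.of_isClosed_subset (hcont.preimage_isClosed_of_isClosed isClosed_Icc
        isClosed_Ici) inter_subset_left
    obtain ⟨r, hr⟩ := hcomp.exists_isGreatest ⟨0, ⟨le_refl _, ht.1⟩, h0⟩
    exact ⟨r, hr.1, fun r' hr' => hr.2 hr'⟩
  have h1 : f r ≤ f t := by
    refine AbsolutelyContinuousOnInterval.le_of_ae_deriv_nonneg hr.1.2 (hf.mono ?_) ?_
    · rw [uIcc_of_le hr.1.2, uIcc_of_le hT]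
      exact Icc_subset_Icc hr.1.1 ht.2
    filter_upwards [h] with x hx hmem
    refine hx ⟨hr.1.1.trans_lt hmem.1, hmem.2.trans_le ht.2⟩ ?_
    by_contra! hcx
    exact absurd (hmax x ⟨⟨(hr.1.1.trans_lt hmem.1).le, hmem.2.le⟩, hcx⟩) (not_le.2 hmem.1)
  have h2 : c ≤ f r := hr.2
  linarith

/-- The Gronwall inequality for absolutely continuous functions. -/
theorem AbsolutelyContinuousOnInterval.gronwall {f : ℝ → ℝ} {T c : ℝ}
    (hf : AbsolutelyContinuousOnInterval f 0 T)
    (h : ∀ᵐ t, t ∈ Ioo 0 T → deriv f t ≤ c * f t) :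
    ∀ t ∈ Icc 0 T, f t ≤ f 0 * Real.exp (c * t) := by
  intro t ht
  have hac : AbsolutelyContinuousOnInterval f 0 t := by
    refine hf.mono ?_
    rw [uIcc_of_le ht.1, uIcc_of_le (ht.1.trans ht.2)]
    exact Icc_subset_Icc_right ht.2
  have hexp : AbsolutelyContinuousOnInterval (fun s => -Real.exp (-c * s)) 0 t :=
    ContDiffOn.absolutelyContinuousOnInterval (by fun_prop)
  have key := AbsolutelyContinuousOnInterval.le_of_ae_deriv_nonneg ht.1 (hexp.fun_mul hac) (by
    filter_upwards [h, hf.ae_differentiableAt_Ioo] with s hs hd hmem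
    have hmem' : s ∈ Ioo 0 T := ⟨hmem.1, hmem.2.trans_le ht.2⟩
    have h1 : HasDerivAt (fun s => -Real.exp (-c * s)) (-(Real.exp (-c * s) * (-c))) s := by
      simpa using (((hasDerivAt_id' s).const_mul (-c)).exp).fun_neg
    rw [(h1.fun_mul (hd hmem').hasDerivAt).deriv]
    nlinarith [hs hmem', Real.exp_pos (-c * s)])
  have h3 : Real.exp (-c * t) * f t ≤ f 0 := by simpa using key
  have h4 : Real.exp (c * t) * Real.exp (-c * t) = 1 := by
    rw [← Real.exp_add]; simp
  calc f t = Real.exp (c * t) * (Real.exp (-c * t) * f t) := by rw [← mul_assoc, h4, one_mul]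
    _ ≤ Real.exp (c * t) * f 0 := by gcongr
    _ = f 0 * Real.exp (c * t) := mul_comm _ _

/-- A locally Lipschitz function on the half-line whose derivative is almost everywhere bounded by
`M` is `M`-Lipschitz. -/
theorem lipschitzOnWith_Ici_of_ae_deriv_le {f : ℝ → ℝ} {M : NNReal}
    (hf : ∀ T, ∃ K, LipschitzOnWith K f (Icc 0 T))
    (h : ∀ᵐ t, 0 < t → |deriv f t| ≤ M) : LipschitzOnWith M f (Ici 0) := by
  have key : ∀ s t, 0 ≤ s → s ≤ t → |f t - f s| ≤ M * (t - s) := by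
    intro s t hs hst
    obtain ⟨K, hK⟩ := hf t
    have hac := (hK.mono (Icc_subset_Icc_left hs)).absolutelyContinuousOnInterval_of_le hst
    have := intervalIntegral.norm_integral_le_of_norm_le_const_ae (f := deriv f) (a := s) (b := t)
      (C := M) (by
        filter_upwards [h] with x hx hmem
        rw [uIoc_of_le hst] at hmem
        exact hx (hs.trans_lt hmem.1))
    rw [hac.integral_deriv_eq_sub, Real.norm_eq_abs, abs_of_nonneg (sub_nonneg.2 hst)] at this
    exact this
  refine LipschitzOnWith.of_dist_le_mul fun s hs t ht => ?_
  rw [Real.dist_eq, Real.dist_eq]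
  rcases le_total s t with hst | hst
  · rw [abs_sub_comm, abs_sub_comm s, abs_of_nonneg (sub_nonneg.2 hst)]
    exact key s t hs hst
  · rw [abs_of_nonneg (sub_nonneg.2 hst)]
    exact key t s ht hst

/-! ### The Sobolev space and the energy -/

namespace MemH10

variable {a b : ℝ} {u v : ℝ → ℝ}

theorem continuous (hv : MemH10 a b v) (hab : a ≤ b) : Continuous v := by
  have h1 : v = fun x => v (max a (min x b)) := by
    funext x
    by_cases hx : x ∈ Icc a b
    · rw [min_eq_left hx.2, max_eq_right hx.1]
    · rw [hv.eq_zero x fun h => hx (Ioo_subset_Icc_self h), hv.eq_zero]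
      simp only [mem_Icc, not_and_or, not_le] at hx
      rcases hx with hx | hx
      · simp [min_eq_left (hx.le.trans hab), max_eq_left hx.le]
      · simp [min_eq_right hx.le, max_eq_right hab]
  rw [h1]
  have h2 := hv.absCont.continuousOn
  rw [uIcc_of_le hab] at h2
  exact h2.comp_continuous (by fun_prop) fun x => ⟨le_max_left _ _, max_le hab (min_le_right _ _)⟩

theorem hasCompactSupport (hv : MemH10 a b v) : HasCompactSupport v :=
  HasCompactSupport.intro isCompact_Icc fun x hx =>
    hv.eq_zero x fun h => hx (Ioo_subset_Icc_self h)

theorem eventuallyEq_zero (hv : MemH10 a b v) {x : ℝ} (hx : x ∉ Icc a b) : v =ᶠ[nhds x] 0 := by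
  filter_upwards [isClosed_Icc.isOpen_compl.mem_nhds hx] with y hy
  exact hv.eq_zero y fun h => hy (Ioo_subset_Icc_self h)

theorem deriv_eq_zero (hv : MemH10 a b v) {x : ℝ} (hx : x ∉ Icc a b) : deriv v x = 0 := by
  rw [(hv.eventuallyEq_zero hx).deriv_eq]
  simp

theorem ae_differentiableAt (hv : MemH10 a b v) (hab : a ≤ b) :
    ∀ᵐ x, DifferentiableAt ℝ v x := by
  filter_upwards [hv.absCont.ae_differentiableAt] with x hx
  rw [uIcc_of_le hab] at hx
  by_cases h : x ∈ Icc a b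
  · exact hx h
  · exact (hv.eventuallyEq_zero h).differentiableAt_iff.2 (differentiableAt_const _)

theorem ae_deriv_sub (hv : MemH10 a b v) (hu : MemH10 a b u) (hab : a ≤ b) :
    ∀ᵐ x, deriv (v - u) x = deriv v x - deriv u x := by
  filter_upwards [hv.ae_differentiableAt hab, hu.ae_differentiableAt hab] with x h1 h2
  exact deriv_sub h1 h2

theorem sub (hv : MemH10 a b v) (hu : MemH10 a b u) (hab : a ≤ b) : MemH10 a b (v - u) where
  eq_zero x hx := by simp [hv.eq_zero x hx, hu.eq_zero x hx]
  absCont := hv.absCont.sub hu.absCont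
  memLp_deriv := (hv.memLp_deriv.sub hu.memLp_deriv).ae_eq <| by
    filter_upwards [hv.ae_deriv_sub hu hab] with x hx
    simp [hx]

theorem integrable (hv : MemH10 a b v) (hab : a ≤ b) : Integrable v :=
  (hv.continuous hab).integrable_of_hasCompactSupport hv.hasCompactSupport

theorem integrable_sq (hv : MemH10 a b v) (hab : a ≤ b) : Integrable fun x => v x ^ 2 :=
  ((hv.continuous hab).pow 2).integrable_of_hasCompactSupport <|
    HasCompactSupport.intro isCompact_Icc fun x (hx : x ∉ Icc a b) => by
      simp [hv.eq_zero x fun h => hx (Ioo_subset_Icc_self h)]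

theorem integrable_deriv_sq (hv : MemH10 a b v) : Integrable fun x => deriv v x ^ 2 :=
  hv.memLp_deriv.integrable_sq

theorem integrable_mul_id (hv : MemH10 a b v) (hab : a ≤ b) : Integrable fun x => v x * x :=
  ((hv.continuous hab).mul continuous_id).integrable_of_hasCompactSupport <|
    HasCompactSupport.intro isCompact_Icc fun x (hx : x ∉ Icc a b) => by
      simp [hv.eq_zero x fun h => hx (Ioo_subset_Icc_self h)]

theorem integrable_energy (hv : MemH10 a b v) (hab : a ≤ b) (κ α : ℝ) :
    Integrable fun x => 1 / 2 * (deriv v x) ^ 2 + (v x) ^ 2 / 2 * κ * Real.cos α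
      - v x * x * κ * Real.sin α := by
  refine ((hv.integrable_deriv_sq.const_mul _).add ?_).sub ?_
  · exact (((hv.integrable_sq hab).div_const 2).mul_const κ).mul_const _
  · exact ((hv.integrable_mul_id hab).mul_const κ).mul_const _

end MemH10

/-- The extension by zero of `p : [a', b] → ℝ` off `(a', b)`. -/
noncomputable def extendZero (a' b : ℝ) (p : ℝ → ℝ) : ℝ → ℝ := (Ioo a' b).indicator p

section ExtendZero

variable {a a' b : ℝ} {p : ℝ → ℝ}

theorem extendZero_of_mem_Icc (ha : p a' = 0) (hb : p b = 0) {x : ℝ} (hx : x ∈ Icc a' b) :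
    extendZero a' b p x = p x := by
  unfold extendZero
  by_cases h : x ∈ Ioo a' b
  · exact indicator_of_mem h p
  · rw [indicator_of_notMem h]
    rcases hx.1.eq_or_lt with rfl | h1
    · exact ha.symm
    · rcases hx.2.eq_or_lt with rfl | h2
      · exact hb.symm
      · exact absurd ⟨h1, h2⟩ h

/-- A continuously differentiable function on `[a', b] ⊆ [a, b]` which vanishes at the endpoints
extends by zero to an element of `H¹₀(a, b)`. -/
theorem memH10_extendZero (haa : a ≤ a') (hab : a' ≤ b) (hp : ContDiff ℝ 1 p)
    (ha : p a' = 0) (hb : p b = 0) : MemH10 a b (extendZero a' b p) := by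
  obtain ⟨K, hK⟩ := (hp.contDiffOn (s := Icc a' b)).exists_lipschitzOnWith (by decide)
    (convex_Icc _ _) isCompact_Icc
  have heq : extendZero a' b p = fun x => p (max a' (min x b)) := by
    funext x
    by_cases hx : x ∈ Icc a' b
    · rw [min_eq_left hx.2, max_eq_right hx.1, extendZero_of_mem_Icc ha hb hx]
    · rw [extendZero, indicator_of_notMem fun h => hx (Ioo_subset_Icc_self h)]
      simp only [mem_Icc, not_and_or, not_le] at hx
      rcases hx with hx | hx
      · simp [min_eq_left (hx.le.trans hab), max_eq_left hx.le, ha]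
      · simp [min_eq_right hx.le, max_eq_right hab, hb]
  have hclamp : LipschitzWith 1 fun x : ℝ => max a' (min x b) :=
    (LipschitzWith.id.min_const b).const_max a'
  have hlip : LipschitzWith K (extendZero a' b p) := by
    rw [heq]
    have := hK.comp (hclamp.lipschitzOnWith (s := univ))
      fun x _ => ⟨le_max_left _ _, max_le hab (min_le_right _ _)⟩
    rw [mul_one, lipschitzOnWith_univ] at this
    exact this
  have hz : ∀ x, x ∉ Ioo a b → extendZero a' b p x = 0 := fun x hx =>
    indicator_of_notMem (fun h => hx ⟨haa.trans_lt h.1, h.2⟩) p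
  refine ⟨hz, (hlip.lipschitzOnWith (s := _)).absolutelyContinuousOnInterval, ?_⟩
  have hd : ∀ x, x ∉ Icc a b → deriv (extendZero a' b p) x = 0 := by
    intro x hx
    have : extendZero a' b p =ᶠ[nhds x] 0 := by
      filter_upwards [isClosed_Icc.isOpen_compl.mem_nhds hx] with y hy
      exact hz y fun h => hy (Ioo_subset_Icc_self h)
    rw [this.deriv_eq]
    simp
  have h2 : deriv (extendZero a' b p) = (Icc a b).indicator (deriv (extendZero a' b p)) := by
    funext x
    by_cases hx : x ∈ Icc a b
    · rw [indicator_of_mem hx]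
    · rw [indicator_of_notMem hx, hd x hx]
  rw [h2, memLp_indicator_iff_restrict measurableSet_Icc]
  exact MemLp.of_bound (measurable_deriv _).aestronglyMeasurable K
    (Filter.Eventually.of_forall fun x => norm_deriv_le_of_lipschitz hlip)

theorem deriv_extendZero {x : ℝ} (hx : x ∈ Ioo a' b) : deriv (extendZero a' b p) x = deriv p x := by
  apply Filter.EventuallyEq.deriv_eq
  filter_upwards [isOpen_Ioo.mem_nhds hx] with y hy
  exact indicator_of_mem hy p

theorem deriv_extendZero_left {x : ℝ} (hx : x < a') : deriv (extendZero a' b p) x = 0 := by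
  have : extendZero a' b p =ᶠ[nhds x] 0 := by
    filter_upwards [isOpen_Iio.mem_nhds hx] with y hy
    exact indicator_of_notMem (fun h => absurd h.1 (not_lt.2 (le_of_lt hy))) p
  rw [this.deriv_eq]
  simp

theorem integral_extendZero (hab : a' ≤ b) : ∫ x, extendZero a' b p x = ∫ x in a'..b, p x := by
  rw [extendZero, integral_indicator measurableSet_Ioo, intervalIntegral.integral_of_le hab,
    integral_Ioc_eq_integral_Ioo]

end ExtendZero

/-- The variational inequality in quantitative form. Let `p` solve the Euler-Lagrange equation
`-p'' + p κ cos α - x κ sin α = lam` and vanish at `a'` and `b`; if `a < a'`, let it leave zero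
tangentially at `a'`, and let the obstacle exert an upward reaction at `a'` (and hence, gravity
being monotone, on all of `(a, a')`). Then the extension of `p` by zero has the least energy, and
the energy of a competitor exceeds it by a multiple of the squared `L²` distance. -/
theorem dropEnergy_add_le {κ α a a' b lam : ℝ} {p p' : ℝ → ℝ} {v : ℝ → ℝ}
    (hs : 0 ≤ κ * Real.sin α) (haa : a ≤ a') (hab : a' ≤ b)
    (hp : ∀ x, HasDerivAt p (p' x) x)
    (hp' : ∀ x, HasDerivAt p' (p x * (κ * Real.cos α) - x * (κ * Real.sin α) - lam) x)
    (ha : p a' = 0) (hb : p b = 0)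
    (hcontact : a < a' → p' a' = 0 ∧ a' * (κ * Real.sin α) + lam ≤ 0)
    (hv : MemH10 a b v) (hv0 : ∀ x, 0 ≤ v x)
    (hint : ∫ x, v x = ∫ x, extendZero a' b p x) :
    dropEnergy κ α (extendZero a' b p) +
      κ * Real.cos α / 2 * ∫ x, (v x - extendZero a' b p x) ^ 2 ≤ dropEnergy κ α v := by
  have hp1 : ContDiff ℝ 1 p := by
    rw [contDiff_one_iff_deriv]
    refine ⟨fun x => (hp x).differentiableAt, ?_⟩
    rw [funext fun x => (hp x).deriv]
    exact continuous_iff_continuousAt.2 fun x => (hp' x).continuousAt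
  have hpc : Continuous p := hp1.continuous
  have hp1' : ContDiff ℝ 1 p' := by
    rw [contDiff_one_iff_deriv]
    refine ⟨fun x => (hp' x).differentiableAt, ?_⟩
    rw [funext fun x => (hp' x).deriv]
    fun_prop
  have hab' : a ≤ b := haa.trans hab
  set U := extendZero a' b p with hU
  have hUm : MemH10 a b U := memH10_extendZero haa hab hp1 ha hb
  set w := v - U with hw
  have hwm : MemH10 a b w := hv.sub hUm hab'
  set c := κ * Real.cos α with hc
  set s := κ * Real.sin α with hs'
  -- the first variation at `U` in the direction `w`, with the multiplier subtracted
  set R : ℝ → ℝ := fun x => (1 / 2 * (deriv v x) ^ 2 + (v x) ^ 2 / 2 * κ * Real.cos α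
      - v x * x * κ * Real.sin α) - (1 / 2 * (deriv U x) ^ 2 + (U x) ^ 2 / 2 * κ * Real.cos α
      - U x * x * κ * Real.sin α) - (1 / 2 * deriv w x ^ 2 + c / 2 * w x ^ 2) - lam * w x with hR
  have hRint : Integrable R :=
    (((hv.integrable_energy hab' κ α).sub (hUm.integrable_energy hab' κ α)).sub
      ((hwm.integrable_deriv_sq.const_mul _).add ((hwm.integrable_sq hab').const_mul _))).sub
      ((hwm.integrable hab').const_mul lam)
  have hRval : ∫ x, R x = dropEnergy κ α v - dropEnergy κ α U
      - (1 / 2 * ∫ x, deriv w x ^ 2) - c / 2 * ∫ x, w x ^ 2 := by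
    have hw0 : ∫ x, w x = 0 := by
      simp only [hw, Pi.sub_apply]
      rw [integral_sub (hv.integrable hab') (hUm.integrable hab'), hint, sub_self]
    simp only [hR]
    rw [integral_sub, integral_sub, integral_sub (hv.integrable_energy hab' κ α)
      (hUm.integrable_energy hab' κ α), integral_add (hwm.integrable_deriv_sq.const_mul _)
      ((hwm.integrable_sq hab').const_mul _), integral_const_mul, integral_const_mul,
      integral_const_mul, hw0]
    · simp only [dropEnergy]; ring
    · exact (hv.integrable_energy hab' κ α).sub (hUm.integrable_energy hab' κ α)
    · exact (hwm.integrable_deriv_sq.const_mul _).add ((hwm.integrable_sq hab').const_mul _)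
    · exact ((hv.integrable_energy hab' κ α).sub (hUm.integrable_energy hab' κ α)).sub
        ((hwm.integrable_deriv_sq.const_mul _).add ((hwm.integrable_sq hab').const_mul _))
    · exact (hwm.integrable hab').const_mul lam
  set E1 : ℝ → ℝ := (Ioc a' b).indicator fun x => deriv p' x * w x + p' x * deriv w x with hE1
  have hwac : AbsolutelyContinuousOnInterval w a' b := by
    refine hwm.absCont.mono ?_
    rw [uIcc_of_le hab, uIcc_of_le hab']
    exact Icc_subset_Icc_left haa
  have hpac : AbsolutelyContinuousOnInterval p' a' b :=
    hp1'.contDiffOn.absolutelyContinuousOnInterval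
  have hE1int : ∫ x, E1 x = 0 := by
    rw [hE1, integral_indicator measurableSet_Ioc, ← intervalIntegral.integral_of_le hab,
      hpac.integral_deriv_mul_eq_sub hwac, hwm.eq_zero b (by simp)]
    rcases haa.eq_or_lt with h | h
    · rw [← h, hwm.eq_zero a (by simp)]; simp
    · rw [(hcontact h).1]; simp
  have hE1i : Integrable E1 := by
    rw [hE1, integrable_indicator_iff measurableSet_Ioc,
      ← intervalIntegrable_iff_integrableOn_Ioc_of_le hab]
    exact (hpac.intervalIntegrable_deriv.mul_continuousOn hwac.continuousOn).add
      (hwac.intervalIntegrable_deriv.continuousOn_mul hpac.continuousOn)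
  have hle : ∀ᵐ x, E1 x ≤ R x := by
    have hne : ∀ y : ℝ, ∀ᵐ x : ℝ, x ≠ y := fun y => by simp [ae_iff]
    filter_upwards [hv.ae_deriv_sub hUm hab', hne a', hne b, hne a] with x hx h1 h2 h3
    have hRx : R x = deriv U x * deriv w x + c * U x * w x - s * x * w x - lam * w x := by
      simp only [hR, hw, hx, Pi.sub_apply, hc, hs']
      ring
    rw [hRx]
    by_cases hin : x ∈ Ioo a' b
    · have e1 : U x = p x := indicator_of_mem hin p
      have e2 : deriv U x = p' x := by rw [hU, deriv_extendZero hin, (hp x).deriv]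
      have e3 : E1 x = deriv p' x * w x + p' x * deriv w x :=
        indicator_of_mem (Ioo_subset_Ioc_self hin) _
      rw [e1, e2, e3, (hp' x).deriv]
      apply le_of_eq
      ring
    · have hnot : x ∉ Ioc a' b := fun h => hin ⟨h.1, lt_of_le_of_ne h.2 h2⟩
      have e3 : E1 x = 0 := indicator_of_notMem hnot _
      have e1 : U x = 0 := indicator_of_notMem hin p
      rw [e3, e1]
      by_cases hxI : x ∈ Icc a b
      · have hxa : x < a' := by
          by_contra! h
          exact hin ⟨lt_of_le_of_ne h (Ne.symm h1), lt_of_le_of_ne hxI.2 h2⟩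
        have e2 : deriv U x = 0 := deriv_extendZero_left hxa
        have e4 : w x = v x := by simp [hw, e1]
        have h5 := (hcontact (hxI.1.trans_lt hxa)).2
        rw [e2, e4]
        nlinarith [mul_nonneg (hv0 x) (mul_nonneg hs (sub_nonneg.2 hxa.le)),
          mul_nonneg (hv0 x) (neg_nonneg.2 h5)]
      · have e4 : w x = 0 := hwm.eq_zero x fun h => hxI (Ioo_subset_Icc_self h)
        rw [e4, hwm.deriv_eq_zero hxI]
        simp
  have h1 : 0 ≤ ∫ x, R x := hE1int ▸ integral_mono_ae hE1i hRint hle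
  have h2 : 0 ≤ ∫ x, deriv w x ^ 2 := integral_nonneg fun x => sq_nonneg _
  rw [hRval] at h1
  have h3 : ∫ x, (v x - U x) ^ 2 = ∫ x, w x ^ 2 := rfl
  rw [h3]
  linarith

/-- Under the hypotheses of `dropEnergy_add_le` the extension by zero of a nonnegative `p` is the
only obstacle minimizer. -/
theorem isObstacleMinimizer_iff {κ α V₀ a a' b lam : ℝ} {p p' : ℝ → ℝ}
    (hc : 0 < κ * Real.cos α) (hs : 0 ≤ κ * Real.sin α) (haa : a ≤ a') (hab : a' ≤ b)
    (hp : ∀ x, HasDerivAt p (p' x) x)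
    (hp' : ∀ x, HasDerivAt p' (p x * (κ * Real.cos α) - x * (κ * Real.sin α) - lam) x)
    (ha : p a' = 0) (hb : p b = 0)
    (hcontact : a < a' → p' a' = 0 ∧ a' * (κ * Real.sin α) + lam ≤ 0)
    (hnonneg : ∀ x ∈ Ioo a' b, 0 ≤ p x) (hint : ∫ x in a'..b, p x = V₀) (u : ℝ → ℝ) :
    IsObstacleMinimizer κ α V₀ a b u ↔ u = extendZero a' b p := by
  have hp1 : ContDiff ℝ 1 p := by
    rw [contDiff_one_iff_deriv]
    refine ⟨fun x => (hp x).differentiableAt, ?_⟩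
    rw [funext fun x => (hp x).deriv]
    exact continuous_iff_continuousAt.2 fun x => (hp' x).continuousAt
  have hUm : MemH10 a b (extendZero a' b p) := memH10_extendZero haa hab hp1 ha hb
  have hadm : extendZero a' b p ∈ admissibleDrops V₀ a b :=
    ⟨hUm, fun x => indicator_nonneg hnonneg x, by rw [integral_extendZero hab, hint]⟩
  have key : ∀ v ∈ admissibleDrops V₀ a b, dropEnergy κ α (extendZero a' b p) +
      κ * Real.cos α / 2 * ∫ x, (v x - extendZero a' b p x) ^ 2 ≤ dropEnergy κ α v :=
    fun v hv => dropEnergy_add_le hs haa hab hp hp' ha hb hcontact hv.1 hv.2.1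
      (by rw [hv.2.2, hadm.2.2])
  have hsq : ∀ v : ℝ → ℝ, 0 ≤ ∫ x, (v x - extendZero a' b p x) ^ 2 :=
    fun v => integral_nonneg fun x => sq_nonneg _
  constructor
  · rintro ⟨hu, hmin⟩
    have h1 := key u hu
    have h2 : dropEnergy κ α u ≤ dropEnergy κ α (extendZero a' b p) := hmin hadm
    have h3 : ∫ x, (u x - extendZero a' b p x) ^ 2 = 0 := by
      have := hsq u
      nlinarith
    have hwm := hu.1.sub hUm (haa.trans hab)
    have h4 := (integral_eq_zero_iff_of_nonneg (fun x => sq_nonneg _)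
      (hwm.integrable_sq (haa.trans hab))).1 h3
    have h5 : u - extendZero a' b p = 0 :=
      Continuous.ae_eq_iff_eq volume (hwm.continuous (haa.trans hab)) continuous_const |>.1 <| by
        filter_upwards [h4] with x hx
        exact pow_eq_zero_iff (two_ne_zero) |>.1 hx
    exact sub_eq_zero.1 h5
  · rintro rfl
    refine ⟨hadm, fun v hv => ?_⟩
    have h1 := key v hv
    have h2 := hsq v
    have : 0 ≤ κ * Real.cos α / 2 * ∫ x, (v x - extendZero a' b p x) ^ 2 := by positivity
    change dropEnergy κ α (extendZero a' b p) ≤ dropEnergy κ α v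
    linarith

/-! ### Reflected differential equations -/

/-- The running maximum over `[0, t]` of the excess of `Y` over the barrier `L`: the least
nondecreasing process `S ≥ 0` with `Y - S ≤ L` (one-dimensional Skorokhod reflection). The interval
`[0, t]` is written as `t • [0, 1]`, so that the maximum is taken over a fixed compact set. -/
noncomputable def runningExcess (L : ℝ) (Y : ℝ → ℝ) (t : ℝ) : ℝ :=
  sSup ((fun θ => max (Y (θ * t) - L) 0) '' Icc 0 1)

section RunningExcess

variable {L : ℝ} {Y Y' : ℝ → ℝ}

theorem continuous_runningExcess (hY : Continuous Y) : Continuous (runningExcess L Y) :=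
  isCompact_Icc.continuous_sSup (f := fun t θ => max (Y (θ * t) - L) 0) (by fun_prop)

theorem exists_runningExcess_eq (hY : Continuous Y) {t : ℝ} (ht : 0 ≤ t) :
    ∃ r ∈ Icc 0 t, runningExcess L Y t = max (Y r - L) 0 := by
  have hc : Continuous fun θ => max (Y (θ * t) - L) 0 := by fun_prop
  obtain ⟨θ, hθ, h⟩ := (isCompact_Icc.image hc).sSup_mem
    ((nonempty_Icc.2 (zero_le_one' ℝ)).image _)
  exact ⟨θ * t, ⟨mul_nonneg hθ.1 ht, mul_le_of_le_one_left ht hθ.2⟩, h.symm⟩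

theorem max_le_runningExcess (hY : Continuous Y) {r t : ℝ} (hr : r ∈ Icc 0 t) :
    max (Y r - L) 0 ≤ runningExcess L Y t := by
  have hc : Continuous fun θ => max (Y (θ * t) - L) 0 := by fun_prop
  refine le_csSup (isCompact_Icc.image hc).bddAbove ?_
  rcases (hr.1.trans hr.2).eq_or_lt with h | h
  · have : r = 0 := le_antisymm (h ▸ hr.2) hr.1
    exact ⟨0, by simp, by simp [this]⟩
  · exact ⟨r / t, ⟨div_nonneg hr.1 h.le, (div_le_one h).2 hr.2⟩, by
      simp [div_mul_cancel₀ r h.ne']⟩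

theorem sub_le_runningExcess (hY : Continuous Y) {r t : ℝ} (hr : r ∈ Icc 0 t) :
    Y r - L ≤ runningExcess L Y t :=
  (le_max_left _ _).trans (max_le_runningExcess hY hr)

theorem runningExcess_nonneg (hY : Continuous Y) {t : ℝ} (ht : 0 ≤ t) :
    0 ≤ runningExcess L Y t :=
  (le_max_right _ _).trans (max_le_runningExcess hY (left_mem_Icc.2 ht))

theorem runningExcess_le (hY : Continuous Y) {t c : ℝ} (ht : 0 ≤ t) (hc : 0 ≤ c)
    (h : ∀ r ∈ Icc 0 t, Y r - L ≤ c) : runningExcess L Y t ≤ c := by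
  obtain ⟨r, hr, he⟩ := exists_runningExcess_eq (L := L) hY ht
  rw [he]
  exact max_le (h r hr) hc

theorem runningExcess_mono (hY : Continuous Y) {s t : ℝ} (hs : 0 ≤ s) (hst : s ≤ t) :
    runningExcess L Y s ≤ runningExcess L Y t :=
  runningExcess_le hY hs (runningExcess_nonneg hY (hs.trans hst)) fun _ hr =>
    sub_le_runningExcess hY ⟨hr.1, hr.2.trans hst⟩

theorem abs_runningExcess_sub_le (hY : Continuous Y) (hY' : Continuous Y') {t c : ℝ} (ht : 0 ≤ t)
    (h : ∀ r ∈ Icc 0 t, |Y r - Y' r| ≤ c) :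
    |runningExcess L Y t - runningExcess L Y' t| ≤ c := by
  have hc : 0 ≤ c := (abs_nonneg _).trans (h 0 (left_mem_Icc.2 ht))
  rw [abs_sub_le_iff]
  constructor
  · rw [sub_le_iff_le_add]
    refine runningExcess_le hY ht (add_nonneg hc (runningExcess_nonneg hY' ht)) fun r hr => ?_
    have := sub_le_runningExcess (L := L) hY' hr
    have := (abs_sub_le_iff.1 (h r hr)).1
    linarith
  · rw [sub_le_iff_le_add]
    refine runningExcess_le hY' ht (add_nonneg hc (runningExcess_nonneg hY ht)) fun r hr => ?_
    have := sub_le_runningExcess (L := L) hY hr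
    have := (abs_sub_le_iff.1 (h r hr)).2
    linarith

theorem runningExcess_congr {t : ℝ} (ht : 0 ≤ t) (h : ∀ r ∈ Icc 0 t, Y r = Y' r) :
    runningExcess L Y t = runningExcess L Y' t := by
  unfold runningExcess
  congr 1
  refine image_congr fun θ hθ => ?_
  rw [h _ ⟨mul_nonneg hθ.1 ht, mul_le_of_le_one_left ht hθ.2⟩]

theorem runningExcess_zero (h : Y 0 ≤ L) : runningExcess L Y 0 = 0 := by
  unfold runningExcess
  simp [h]

theorem runningExcess_lipschitzOnWith (hY : Continuous Y) {K : NNReal} {T : ℝ}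
    (hK : LipschitzOnWith K Y (Icc 0 T)) : LipschitzOnWith K (runningExcess L Y) (Icc 0 T) := by
  have key : ∀ s t, 0 ≤ s → s ≤ t → t ≤ T →
      runningExcess L Y t - runningExcess L Y s ≤ K * (t - s) := by
    intro s t hs hst htT
    rw [sub_le_iff_le_add]
    have hp : 0 ≤ K * (t - s) := mul_nonneg K.2 (sub_nonneg.2 hst)
    refine runningExcess_le hY (hs.trans hst)
      (add_nonneg hp (runningExcess_nonneg hY hs)) fun r hr => ?_
    rcases le_total r s with h | h
    · have := sub_le_runningExcess (L := L) hY (t := s) ⟨hr.1, h⟩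
      linarith
    · have h1 := sub_le_runningExcess (L := L) hY (right_mem_Icc.2 hs)
      have h2 := hK.dist_le_mul r ⟨hr.1, hr.2.trans htT⟩ s ⟨hs, hst.trans htT⟩
      rw [Real.dist_eq, Real.dist_eq, abs_of_nonneg (sub_nonneg.2 h)] at h2
      have h3 : (K : ℝ) * (r - s) ≤ K * (t - s) :=
        mul_le_mul_of_nonneg_left (by linarith [hr.2]) K.2
      have := (abs_le.1 h2).2
      linarith
  refine LipschitzOnWith.of_dist_le_mul fun s hs t ht => ?_
  rw [Real.dist_eq, Real.dist_eq]
  rcases le_total s t with h | h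
  · rw [abs_sub_comm, abs_sub_comm s, abs_of_nonneg (sub_nonneg.2 h),
      abs_of_nonneg (sub_nonneg.2 (runningExcess_mono hY hs.1 h))]
    exact key s t hs.1 h ht.2
  · rw [abs_of_nonneg (sub_nonneg.2 h),
      abs_of_nonneg (sub_nonneg.2 (runningExcess_mono hY ht.1 h))]
    exact key t s ht.1 h hs.2

/-- The reflection acts only while `Y - S` sits at the barrier. -/
theorem runningExcess_eventuallyEq (hY : Continuous Y) {t : ℝ} (ht : 0 < t)
    (h : Y t - runningExcess L Y t < L) :
    runningExcess L Y =ᶠ[nhds t] fun _ => runningExcess L Y t := by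
  set S := runningExcess L Y with hS
  have hev : ∀ᶠ r in nhds t, Y r - L < S t :=
    (show Continuous fun r => Y r - L by fun_prop).continuousAt.eventually_lt continuousAt_const
      (by linarith)
  obtain ⟨ε, hε, hball⟩ := Metric.eventually_nhds_iff.1 hev
  rw [Filter.EventuallyEq, Metric.eventually_nhds_iff]
  refine ⟨min ε t, lt_min hε ht, fun r hr => ?_⟩
  rw [Real.dist_eq, abs_lt] at hr
  have hr0 : 0 ≤ r := by linarith [min_le_right ε t]
  have hin : ∀ x, t - min ε t < x → x < t + min ε t → Y x - L < S t := fun x h1 h2 =>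
    hball (by rw [Real.dist_eq, abs_lt]; constructor <;> linarith [min_le_left ε t])
  rcases le_total r t with hrt | hrt
  · refine le_antisymm (runningExcess_mono hY hr0 hrt) ?_
    obtain ⟨x, hx, he⟩ := exists_runningExcess_eq (L := L) hY ht.le
    rcases le_total x r with hxr | hxr
    · rw [hS, he]
      exact max_le_runningExcess hY ⟨hx.1, hxr⟩
    · have h1 := hin x (by linarith) (by linarith [hx.2, lt_min hε ht])
      rcases le_total (Y x - L) 0 with h0 | h0
      · rw [hS, he, max_eq_right h0]
        exact runningExcess_nonneg hY hr0
      · rw [max_eq_left h0, ← hS] at he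
        linarith
  · refine le_antisymm (runningExcess_le hY hr0 (runningExcess_nonneg hY ht.le) fun x hx => ?_)
      (runningExcess_mono hY ht.le hrt)
    rcases le_total x t with hxt | hxt
    · exact sub_le_runningExcess hY ⟨hx.1, hxt⟩
    · exact (hin x (by linarith [lt_min hε ht]) (by linarith [hx.2])).le

end RunningExcess

theorem abs_integral_mul_exp_neg_le {f : ℝ → ℝ} {μ C t : ℝ} (hμ : 0 < μ)
    (ht : 0 ≤ t) (hC : 0 ≤ C) (h : ∀ s, 0 ≤ s → |f s| ≤ C * Real.exp (μ * s)) :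
    |∫ s in 0..t, f s| * Real.exp (-(μ * t)) ≤ C / μ := by
  have h1 : |∫ s in 0..t, f s| ≤ ∫ s in 0..t, C * Real.exp (μ * s) := by
    rw [← Real.norm_eq_abs]
    refine intervalIntegral.norm_integral_le_of_norm_le ht ?_
      (Continuous.intervalIntegrable (by fun_prop) _ _)
    exact Filter.Eventually.of_forall fun s hs => h s hs.1.le
  have h2 : ∫ s in 0..t, C * Real.exp (μ * s) = C / μ * (Real.exp (μ * t) - 1) := by
    have hd : ∀ x ∈ uIcc 0 t,
        HasDerivAt (fun s => C / μ * Real.exp (μ * s)) (C * Real.exp (μ * x)) x := fun x _ => by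
      have h6 := (((hasDerivAt_id' x).const_mul μ).exp).const_mul (C / μ)
      have h7 : C / μ * (Real.exp (μ * x) * (μ * 1)) = C * Real.exp (μ * x) := by
        field_simp
      rwa [h7] at h6
    rw [intervalIntegral.integral_eq_sub_of_hasDerivAt hd
      (Continuous.intervalIntegrable (by fun_prop) _ _)]
    simp
    ring
  have h3 : Real.exp (μ * t) * Real.exp (-(μ * t)) = 1 := by
    rw [← Real.exp_add]; simp
  have h4 := mul_le_mul_of_nonneg_right (h1.trans_eq h2) (Real.exp_pos (-(μ * t))).le
  refine h4.trans ?_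
  have h5 : C / μ * (Real.exp (μ * t) - 1) * Real.exp (-(μ * t))
      = C / μ - C / μ * Real.exp (-(μ * t)) := by
    linear_combination (C / μ) * h3
  rw [h5]
  have := mul_nonneg (div_nonneg hC hμ.le) (Real.exp_pos (-(μ * t))).le
  linarith

/-- Global existence for a Lipschitz differential equation in the plane whose second component is
reflected downwards at the barrier `L`. The Picard operator, composed with the reflection map, is a
contraction of the space of functions that grow at most like `exp (μ t)`. -/
theorem exists_reflected_solution {N₁ N₂ : ℝ → ℝ → ℝ} {M : ℝ} (hM : 0 < M)
    (h₁ : ∀ x y x' y', |N₁ x y - N₁ x' y'| ≤ M * (|x - x'| + |y - y'|))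
    (h₂ : ∀ x y x' y', |N₂ x y - N₂ x' y'| ≤ M * (|x - x'| + |y - y'|)) (b₀ l₀ L : ℝ) :
    ∃ b Y : ℝ → ℝ, b 0 = b₀ ∧ Y 0 = l₀ ∧ Continuous Y ∧ ∀ t, 0 ≤ t →
      HasDerivAt b (N₁ (b t) (Y t - runningExcess L Y t)) t ∧
      HasDerivAt Y (N₂ (b t) (Y t - runningExcess L Y t)) t := by
  have hcont : ∀ N : ℝ → ℝ → ℝ, (∀ x y x' y', |N x y - N x' y'| ≤ M * (|x - x'| + |y - y'|)) →
      Continuous fun q : ℝ × ℝ => N q.1 q.2 := by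
    intro N hN
    refine LipschitzWith.continuous (K := ⟨2 * M, by positivity⟩) <|
      LipschitzWith.of_dist_le_mul fun p q => ?_
    rw [Real.dist_eq, Prod.dist_eq, Real.dist_eq, Real.dist_eq]
    refine (hN _ _ _ _).trans ?_
    have e1 := le_max_left |p.1 - q.1| |p.2 - q.2|
    have e2 := le_max_right |p.1 - q.1| |p.2 - q.2|
    change _ ≤ 2 * M * _
    nlinarith
  obtain ⟨μ, hμ⟩ : ∃ μ, μ = 6 * M := ⟨_, rfl⟩
  have hμ0 : 0 < μ := by linarith
  let X := BoundedContinuousFunction ℝ (ℝ × ℝ)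
  -- the path of the second component encoded by `z`, and the velocity along it
  let Yz : X → ℝ → ℝ := fun z t => (z t).2 * Real.exp (μ * t)
  let V : (ℝ → ℝ → ℝ) → X → ℝ → ℝ := fun N z s =>
    N ((z s).1 * Real.exp (μ * s)) (Yz z s - runningExcess L (Yz z) s)
  have hYc : ∀ z : X, Continuous (Yz z) := fun z => by
    have := z.continuous
    fun_prop
  have hVc : ∀ N : ℝ → ℝ → ℝ, (∀ x y x' y', |N x y - N x' y'| ≤ M * (|x - x'| + |y - y'|)) →
      ∀ z, Continuous (V N z) := fun N hN z => by
    have e1 := z.continuous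
    have e2 := hYc z
    have e3 := continuous_runningExcess (L := L) e2
    exact (hcont N hN).comp (f := fun s => ((z s).1 * Real.exp (μ * s),
      Yz z s - runningExcess L (Yz z) s)) (by fun_prop)
  have hVdist : ∀ N : ℝ → ℝ → ℝ, (∀ x y x' y', |N x y - N x' y'| ≤ M * (|x - x'| + |y - y'|)) →
      ∀ z z' : X, ∀ s, 0 ≤ s → |V N z s - V N z' s| ≤ 3 * M * dist z z' * Real.exp (μ * s) := by
    intro N hN z z' s hs
    refine (hN _ _ _ _).trans ?_
    have d0 : ∀ r, dist (z r) (z' r) ≤ dist z z' := fun r =>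
      BoundedContinuousFunction.dist_coe_le_dist r
    have d1 : |(z s).1 * Real.exp (μ * s) - (z' s).1 * Real.exp (μ * s)|
        ≤ dist z z' * Real.exp (μ * s) := by
      rw [← sub_mul, abs_mul, abs_of_pos (Real.exp_pos _)]
      gcongr
      exact (le_max_left _ _).trans (d0 s)
    have d2 : ∀ r ∈ Icc 0 s, |Yz z r - Yz z' r| ≤ dist z z' * Real.exp (μ * s) := by
      intro r hr
      simp only [Yz]
      rw [← sub_mul, abs_mul, abs_of_pos (Real.exp_pos _)]
      have : Real.exp (μ * r) ≤ Real.exp (μ * s) :=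
        Real.exp_le_exp.2 (mul_le_mul_of_nonneg_left hr.2 hμ0.le)
      gcongr
      exact (le_max_right _ _).trans (d0 r)
    have d3 := abs_runningExcess_sub_le (L := L) (hYc z) (hYc z') hs d2
    have d4 := d2 s (right_mem_Icc.2 hs)
    have d5 : |Yz z s - runningExcess L (Yz z) s - (Yz z' s - runningExcess L (Yz z') s)|
        ≤ 2 * (dist z z' * Real.exp (μ * s)) := by
      rw [abs_le] at *
      constructor <;> linarith
    nlinarith
  -- one component of the Picard operator, in the weighted variable
  let Φ : (ℝ → ℝ → ℝ) → ℝ → X → ℝ → ℝ := fun N c z t =>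
    (c + ∫ s in 0..max t 0, V N z s) * Real.exp (-(μ * max t 0))
  have hΦc : ∀ N : ℝ → ℝ → ℝ, (∀ x y x' y', |N x y - N x' y'| ≤ M * (|x - x'| + |y - y'|)) →
      ∀ c z, Continuous (Φ N c z) := by
    intro N hN c z
    have : Continuous fun t => ∫ s in 0..t, V N z s :=
      intervalIntegral.continuous_primitive (fun a b => (hVc N hN z).intervalIntegrable a b) 0
    have h2 : Continuous fun t : ℝ => ∫ s in 0..max t 0, V N z s :=
      this.comp (f := fun t : ℝ => max t 0) (by fun_prop)
    fun_prop
  have hΦdist : ∀ N : ℝ → ℝ → ℝ, (∀ x y x' y', |N x y - N x' y'| ≤ M * (|x - x'| + |y - y'|)) →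
      ∀ c, ∀ z z' : X, ∀ t, |Φ N c z t - Φ N c z' t| ≤ 1 / 2 * dist z z' := by
    intro N hN c z z' t
    have e1 : Φ N c z t - Φ N c z' t =
        (∫ s in 0..max t 0, (V N z s - V N z' s)) * Real.exp (-(μ * max t 0)) := by
      simp only [Φ]
      rw [intervalIntegral.integral_sub ((hVc N hN z).intervalIntegrable _ _)
        ((hVc N hN z').intervalIntegrable _ _)]
      ring
    rw [e1, abs_mul, abs_of_pos (Real.exp_pos _)]
    refine (abs_integral_mul_exp_neg_le hμ0 (le_max_right _ _)
      (by positivity) (hVdist N hN z z')).trans (le_of_eq ?_)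
    rw [hμ]
    field_simp
    ring
  have hΦbdd : ∀ N : ℝ → ℝ → ℝ, (∀ x y x' y', |N x y - N x' y'| ≤ M * (|x - x'| + |y - y'|)) →
      ∀ c z, ∃ C, ∀ t, |Φ N c z t| ≤ C := by
    intro N hN c z
    -- compare with the operator at `0`, along which the velocity is constant
    have z0 : ∀ r, (0 : X) r = 0 := fun r => rfl
    have hV0 : ∀ s, 0 ≤ s → |V N 0 s| ≤ |V N 0 0| * Real.exp (μ * s) := by
      intro s hs
      have e1 : Yz 0 = fun _ => (0 : ℝ) := by
        funext r
        simp [Yz, z0]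
      have e2 : V N 0 s = V N 0 0 := by
        simp only [V, e1]
        simp [runningExcess, z0]
      rw [e2]
      exact le_mul_of_one_le_right (abs_nonneg _)
        (Real.one_le_exp (mul_nonneg hμ0.le hs))
    refine ⟨1 / 2 * dist z 0 + (|c| + |V N 0 0| / μ), fun t => ?_⟩
    have e3 := hΦdist N hN c z 0 t
    have e4 : |Φ N c 0 t| ≤ |c| + |V N 0 0| / μ := by
      simp only [Φ]
      rw [add_mul]
      refine (abs_add_le _ _).trans (add_le_add ?_ ?_)
      · rw [abs_mul, abs_of_pos (Real.exp_pos _)]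
        refine mul_le_of_le_one_right (abs_nonneg _) (Real.exp_le_one_iff.2 ?_)
        have : 0 ≤ μ * max t 0 := mul_nonneg hμ0.le (le_max_right _ _)
        linarith
      · rw [abs_mul, abs_of_pos (Real.exp_pos _)]
        exact abs_integral_mul_exp_neg_le hμ0 (le_max_right _ _) (abs_nonneg _) hV0
    have e5 : |Φ N c z t| ≤ |Φ N c z t - Φ N c 0 t| + |Φ N c 0 t| := by
      simpa using abs_add_le (Φ N c z t - Φ N c 0 t) (Φ N c 0 t)
    linarith
  have hbd : ∀ z, ∃ C, ∀ t, ‖(Φ N₁ b₀ z t, Φ N₂ l₀ z t)‖ ≤ C := fun z => by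
    obtain ⟨C₁, hC₁⟩ := hΦbdd N₁ h₁ b₀ z
    obtain ⟨C₂, hC₂⟩ := hΦbdd N₂ h₂ l₀ z
    exact ⟨max C₁ C₂, fun t => max_le_max (hC₁ t) (hC₂ t)⟩
  let Ψ : X → X := fun z => BoundedContinuousFunction.ofNormedAddCommGroup
    (fun t => (Φ N₁ b₀ z t, Φ N₂ l₀ z t)) ((hΦc N₁ h₁ b₀ z).prodMk (hΦc N₂ h₂ l₀ z))
    (hbd z).choose (hbd z).choose_spec
  have hΨ : ContractingWith (1 / 2 : NNReal) Ψ := by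
    refine ⟨by norm_num, LipschitzWith.of_dist_le_mul fun z z' => ?_⟩
    rw [BoundedContinuousFunction.dist_le (by positivity)]
    intro t
    push_cast
    exact max_le (hΦdist N₁ h₁ b₀ z z' t) (hΦdist N₂ h₂ l₀ z z' t)
  set z := hΨ.fixedPoint with hz
  have hfix : ∀ t, 0 ≤ t → (z t).1 * Real.exp (μ * t) = b₀ + ∫ s in 0..t, V N₁ z s ∧
      (z t).2 * Real.exp (μ * t) = l₀ + ∫ s in 0..t, V N₂ z s := by
    intro t ht
    have e1 : Ψ z = z := hΨ.fixedPoint_isFixedPt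
    have e2 : z t = (Φ N₁ b₀ z t, Φ N₂ l₀ z t) := by
      conv_lhs => rw [← e1]
      rfl
    have e3 : Real.exp (-(μ * t)) * Real.exp (μ * t) = 1 := by
      rw [← Real.exp_add]; simp
    rw [e2]
    simp only [Φ, max_eq_left ht]
    rw [mul_assoc, mul_assoc, e3, mul_one, mul_one]
    exact ⟨rfl, rfl⟩
  have hVd : ∀ N : ℝ → ℝ → ℝ, (∀ x y x' y', |N x y - N x' y'| ≤ M * (|x - x'| + |y - y'|)) →
      ∀ c t, HasDerivAt (fun t => c + ∫ s in 0..t, V N z s) (V N z t) t := fun N hN c t =>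
    (intervalIntegral.integral_hasDerivAt_right ((hVc N hN z).intervalIntegrable _ _)
      (hVc N hN z).aestronglyMeasurable.stronglyMeasurableAtFilter
      (hVc N hN z).continuousAt).const_add c
  refine ⟨fun t => b₀ + ∫ s in 0..t, V N₁ z s, fun t => l₀ + ∫ s in 0..t, V N₂ z s, by simp,
    by simp, continuous_iff_continuousAt.2 fun t => (hVd N₂ h₂ l₀ t).continuousAt,
    fun t ht => ?_⟩
  have e1 : runningExcess L (fun t => l₀ + ∫ s in 0..t, V N₂ z s) t
      = runningExcess L (Yz z) t :=
    runningExcess_congr ht fun r hr => ((hfix r hr.1).2).symm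
  have e2 := (hfix t ht).1
  have e3 := (hfix t ht).2
  have e4 : ∀ N, V N z t = N (b₀ + ∫ s in 0..t, V N₁ z s) (l₀ + (∫ s in 0..t, V N₂ z s)
      - runningExcess L (fun t => l₀ + ∫ s in 0..t, V N₂ z s) t) := by
    intro N
    rw [e1, ← e2, ← e3]
  exact ⟨e4 N₁ ▸ hVd N₁ h₁ b₀ t, e4 N₂ ▸ hVd N₂ h₂ l₀ t⟩

/-! ### The reduced dynamics of the endpoints -/

/-- What the dynamics needs to know of the sum `e l` of the driving terms at the two endpoints of a
drop of length `l`: it is smooth and decreasing for lengths up to the maximal length `L`, and it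
blows up for short drops. -/
structure IsSpreadingLaw (e : ℝ → ℝ) (L : ℝ) : Prop where
  pos : 0 < L
  contDiffOn : ContDiffOn ℝ 1 e (Ioi 0)
  deriv_nonpos : ∀ x ∈ Ioc 0 L, deriv e x ≤ 0
  blowup : ∀ R, ∃ δ > 0, ∀ x ∈ Ioc 0 δ, R ≤ e x

/-- The right endpoint `b` and the length `l` of a drop on the time interval `[0, T]`, governed by
a differential equation in which `l` is reflected downwards at the maximal length `L`. The left
endpoint is `b - l`. -/
structure IsDropFlow (e β : ℝ → ℝ) (γ L b₀ l₀ T : ℝ) (b l : ℝ → ℝ) : Prop where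
  lipschitz_b : ∃ K, LipschitzOnWith K b (Icc 0 T)
  lipschitz_l : ∃ K, LipschitzOnWith K l (Icc 0 T)
  b_zero : b 0 = b₀
  l_zero : l 0 = l₀
  mem : ∀ t ∈ Icc 0 T, l t ∈ Ioc 0 L
  deriv_b : ∀ᵐ t, t ∈ Ioo 0 T → deriv b t = e (l t) / 2 + γ - β (b t)
  deriv_l_le : ∀ᵐ t, t ∈ Ioo 0 T → deriv l t ≤ e (l t) - β (b t) - β (b t - l t)
  deriv_l_eq : ∀ᵐ t, t ∈ Ioo 0 T → l t < L → deriv l t = e (l t) - β (b t) - β (b t - l t)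

theorem IsSpreadingLaw.differentiableAt {e : ℝ → ℝ} {L : ℝ} (he : IsSpreadingLaw e L) {x : ℝ}
    (hx : 0 < x) : DifferentiableAt ℝ e x :=
  (he.contDiffOn.differentiableOn (by decide)).differentiableAt (Ioi_mem_nhds hx)

theorem IsSpreadingLaw.exists_lipschitzOnWith {e : ℝ → ℝ} {L : ℝ} (he : IsSpreadingLaw e L) {δ : ℝ}
    (hδ : 0 < δ) : ∃ K, LipschitzOnWith K e (Icc δ L) :=
  (he.contDiffOn.mono fun _ hx => hδ.trans_le hx.1).exists_lipschitzOnWith (by decide)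
    (convex_Icc _ _) isCompact_Icc

theorem LipschitzWith.abs_sub_le {β : ℝ → ℝ} {K : NNReal} (hβ : LipschitzWith K β) (x y : ℝ) :
    |β x - β y| ≤ K * |x - y| := hβ.dist_le_mul x y

theorem LipschitzWith.abs_add_sub_two_mul_le {β : ℝ → ℝ} {K : NNReal} (hβ : LipschitzWith K β)
    {l : ℝ} (hl : 0 ≤ l) (b : ℝ) : |β b + β (b - l) - 2 * β (b - l / 2)| ≤ K * l := by
  have h1 := hβ.abs_sub_le b (b - l / 2)
  have h2 := hβ.abs_sub_le (b - l) (b - l / 2)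
  rw [show b - (b - l / 2) = l / 2 by ring, abs_of_nonneg (show 0 ≤ l / 2 by linarith)] at h1
  rw [show b - l - (b - l / 2) = -(l / 2) by ring, abs_neg, abs_of_nonneg (show 0 ≤ l / 2 by linarith)] at h2
  rw [abs_le] at *
  constructor <;> linarith

theorem quadratic_drift_le {M K x y E P Q : ℝ} (hM : 0 ≤ M) (hK : 0 ≤ K) (hE : |E| ≤ M * |y|)
    (hP : |P| ≤ K * |x|) (hQ : |Q| ≤ K * (|x| + |y|)) :
    2 * ((E / 2 - P) * x) + 2 * ((E - P - Q) * y) ≤ (3 * M + 6 * K) * (x * x + y * y) := by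
  have r1 : (E / 2 - P) * x ≤ (M / 2 * |y| + K * |x|) * |x| := by
    refine (le_abs_self _).trans ?_
    rw [abs_mul]
    refine mul_le_mul_of_nonneg_right ?_ (abs_nonneg _)
    rw [abs_le] at *
    constructor <;> linarith
  have r2 : (E - P - Q) * y ≤ (M * |y| + K * |x| + K * (|x| + |y|)) * |y| := by
    refine (le_abs_self _).trans ?_
    rw [abs_mul]
    refine mul_le_mul_of_nonneg_right ?_ (abs_nonneg _)
    rw [abs_le] at *
    constructor <;> linarith
  rw [← abs_mul_abs_self x, ← abs_mul_abs_self y]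
  have r3 : |x| * |y| ≤ (|x| * |x| + |y| * |y|) / 2 := by nlinarith [sq_nonneg (|x| - |y|)]
  have r4 := mul_le_mul_of_nonneg_left r3 hM
  have r5 := mul_le_mul_of_nonneg_left r3 hK
  have r6 : 0 ≤ M * (|x| * |x|) := by positivity
  have r7 : 0 ≤ M * (|y| * |y|) := by positivity
  have r8 : 0 ≤ K * (|x| * |x|) := by positivity
  have r9 : 0 ≤ K * (|y| * |y|) := by positivity
  linarith

namespace IsDropFlow

variable {e β : ℝ → ℝ} {γ L b₀ l₀ T : ℝ} {b l b' l' : ℝ → ℝ}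

theorem ae_differentiableAt (h : IsDropFlow e β γ L b₀ l₀ T b l) :
    ∀ᵐ t, t ∈ Ioo 0 T → DifferentiableAt ℝ b t ∧ DifferentiableAt ℝ l t := by
  rcases le_total 0 T with hT | hT
  · obtain ⟨K₁, h₁⟩ := h.lipschitz_b
    obtain ⟨K₂, h₂⟩ := h.lipschitz_l
    filter_upwards [(h₁.absolutelyContinuousOnInterval_of_le hT).ae_differentiableAt_Ioo,
      (h₂.absolutelyContinuousOnInterval_of_le hT).ae_differentiableAt_Ioo] with t h3 h4 ht
    exact ⟨h3 ht, h4 ht⟩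
  · exact Filter.Eventually.of_forall fun t ht => absurd (ht.1.trans ht.2) (not_lt.2 hT)

/-- Almost every time belongs to one of two regimes: free motion of a drop of less than maximal
length, or rigid motion at maximal length. In the second regime the length is stationary because
it is maximal. -/
theorem ae_regime (h : IsDropFlow e β γ L b₀ l₀ T b l) :
    ∀ᵐ t, t ∈ Ioo 0 T → DifferentiableAt ℝ b t ∧ DifferentiableAt ℝ l t ∧
      deriv b t = e (l t) / 2 + γ - β (b t) ∧
      ((l t < L ∧ deriv l t = e (l t) - β (b t) - β (b t - l t)) ∨
        (l t = L ∧ deriv l t = 0 ∧ 0 ≤ e (l t) - β (b t) - β (b t - l t))) := by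
  filter_upwards [h.ae_differentiableAt, h.deriv_b, h.deriv_l_le, h.deriv_l_eq]
    with t h1 h2 h3 h4 ht
  refine ⟨(h1 ht).1, (h1 ht).2, h2 ht, ?_⟩
  rcases (h.mem t (Ioo_subset_Icc_self ht)).2.lt_or_eq with hlt | heq
  · exact Or.inl ⟨hlt, h4 ht hlt⟩
  · have hmax : IsLocalMax l t := by
      filter_upwards [Icc_mem_nhds ht.1 ht.2] with s hs
      rw [heq]
      exact (h.mem s hs).2
    have h5 := hmax.deriv_eq_zero
    exact Or.inr ⟨heq, h5, h5 ▸ h3 ht⟩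

theorem mono (h : IsDropFlow e β γ L b₀ l₀ T b l) {T' : ℝ} (hT : T' ≤ T) :
    IsDropFlow e β γ L b₀ l₀ T' b l where
  lipschitz_b := h.lipschitz_b.imp fun _ hK => hK.mono (Icc_subset_Icc_right hT)
  lipschitz_l := h.lipschitz_l.imp fun _ hK => hK.mono (Icc_subset_Icc_right hT)
  b_zero := h.b_zero
  l_zero := h.l_zero
  mem t ht := h.mem t (Icc_subset_Icc_right hT ht)
  deriv_b := h.deriv_b.mono fun _ h1 ht => h1 (Ioo_subset_Ioo_right hT ht)
  deriv_l_le := h.deriv_l_le.mono fun _ h1 ht => h1 (Ioo_subset_Ioo_right hT ht)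
  deriv_l_eq := h.deriv_l_eq.mono fun _ h1 ht => h1 (Ioo_subset_Ioo_right hT ht)

theorem congr (h : IsDropFlow e β γ L b₀ l₀ T b l) (hT : 0 ≤ T)
    (hb : ∀ t ∈ Icc 0 T, b' t = b t) (hl : ∀ t ∈ Icc 0 T, l' t = l t) :
    IsDropFlow e β γ L b₀ l₀ T b' l' := by
  have key : ∀ {f g : ℝ → ℝ}, (∀ t ∈ Icc 0 T, f t = g t) → ∀ t ∈ Ioo 0 T,
      f t = g t ∧ deriv f t = deriv g t := fun {f g} hfg t ht =>
    ⟨hfg t (Ioo_subset_Icc_self ht), Filter.EventuallyEq.deriv_eq <| by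
      filter_upwards [Icc_mem_nhds ht.1 ht.2] with s hs using hfg s hs⟩
  constructor
  · obtain ⟨K, hK⟩ := h.lipschitz_b
    exact ⟨K, fun s hs t ht => by rw [hb s hs, hb t ht]; exact hK hs ht⟩
  · obtain ⟨K, hK⟩ := h.lipschitz_l
    exact ⟨K, fun s hs t ht => by rw [hl s hs, hl t ht]; exact hK hs ht⟩
  · rw [hb 0 ⟨le_rfl, hT⟩, h.b_zero]
  · rw [hl 0 ⟨le_rfl, hT⟩, h.l_zero]
  · intro t ht
    rw [hl t ht]
    exact h.mem t ht
  · filter_upwards [h.deriv_b] with t h1 ht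
    rw [(key hb t ht).1, (key hb t ht).2, (key hl t ht).1, h1 ht]
  · filter_upwards [h.deriv_l_le] with t h1 ht
    rw [(key hb t ht).1, (key hl t ht).2, (key hl t ht).1]
    exact h1 ht
  · filter_upwards [h.deriv_l_eq] with t h1 ht
    rw [(key hb t ht).1, (key hl t ht).2, (key hl t ht).1]
    exact h1 ht

theorem exists_pos_le (h : IsDropFlow e β γ L b₀ l₀ T b l) (hT : 0 ≤ T) :
    ∃ δ > 0, ∀ t ∈ Icc 0 T, δ ≤ l t := by
  obtain ⟨K, hK⟩ := h.lipschitz_l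
  obtain ⟨t, ht, hmin⟩ := isCompact_Icc.exists_isMinOn (nonempty_Icc.2 hT) hK.continuousOn
  exact ⟨l t, (h.mem t ht).1, fun s hs => hmin hs⟩

/-- Uniqueness: in the coordinates `b` and `l` the reflection is along the normal of the constraint
`l ≤ L`, so that it can only decrease the distance between two flows. -/
theorem unique (he : IsSpreadingLaw e L) {K : NNReal} (hβ : LipschitzWith K β)
    (h : IsDropFlow e β γ L b₀ l₀ T b l) (h' : IsDropFlow e β γ L b₀ l₀ T b' l') :
    ∀ t ∈ Icc 0 T, b' t = b t ∧ l' t = l t := by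
  intro t ht
  have hT : 0 ≤ T := ht.1.trans ht.2
  obtain ⟨δ₁, hδ₁, hl₁⟩ := h.exists_pos_le hT
  obtain ⟨δ₂, hδ₂, hl₂⟩ := h'.exists_pos_le hT
  obtain ⟨M, hM⟩ := he.exists_lipschitzOnWith (lt_min hδ₁ hδ₂)
  have hac : ∀ {f : ℝ → ℝ}, (∃ K, LipschitzOnWith K f (Icc 0 T)) →
      AbsolutelyContinuousOnInterval f 0 T := fun ⟨_, hK⟩ =>
    hK.absolutelyContinuousOnInterval_of_le hT
  have hx := (hac h'.lipschitz_b).fun_sub (hac h.lipschitz_b)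
  have hy := (hac h'.lipschitz_l).fun_sub (hac h.lipschitz_l)
  have hD := (hx.fun_mul hx).fun_add (hy.fun_mul hy)
  have key := hD.gronwall (c := 3 * M + 6 * K) (by
    filter_upwards [h.ae_regime, h'.ae_regime] with s h1 h2 hs
    obtain ⟨db, dl, eb, hl⟩ := h1 hs
    obtain ⟨db', dl', eb', hl'⟩ := h2 hs
    have hsI := Ioo_subset_Icc_self hs
    have hbs := db'.hasDerivAt.fun_sub db.hasDerivAt
    have hls := dl'.hasDerivAt.fun_sub dl.hasDerivAt
    rw [((hbs.fun_mul hbs).fun_add (hls.fun_mul hls)).deriv]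
    have q1 : |e (l' s) - e (l s)| ≤ M * |l' s - l s| :=
      hM.dist_le_mul _ ⟨(min_le_right _ _).trans (hl₂ s hsI), (h'.mem s hsI).2⟩ _
        ⟨(min_le_left _ _).trans (hl₁ s hsI), (h.mem s hsI).2⟩
    have q2 := hβ.abs_sub_le (b' s) (b s)
    have q3 : |β (b' s - l' s) - β (b s - l s)| ≤ K * (|b' s - b s| + |l' s - l s|) := by
      refine (hβ.abs_sub_le _ _).trans (mul_le_mul_of_nonneg_left ?_ K.2)
      rw [show b' s - l' s - (b s - l s) = (b' s - b s) + -(l' s - l s) by ring,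
        ← abs_neg (l' s - l s)]
      exact abs_add_le _ _
    rw [eb, eb']
    -- the reflection terms have the favourable sign
    have q4 : (deriv l' s - deriv l s) * (l' s - l s) ≤ ((e (l' s) - β (b' s) - β (b' s - l' s))
        - (e (l s) - β (b s) - β (b s - l s))) * (l' s - l s) := by
      rcases hl with ⟨g1, g2⟩ | ⟨g1, g2, g3⟩ <;> rcases hl' with ⟨k1, k2⟩ | ⟨k1, k2, k3⟩
      · rw [g2, k2]
      · rw [g2, k2]
        nlinarith [mul_nonneg k3 (sub_nonneg.2 (g1.le.trans_eq k1.symm))]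
      · rw [g2, k2]
        nlinarith [mul_nonneg g3 (sub_nonneg.2 (k1.le.trans_eq g1.symm))]
      · rw [g1, k1]
        simp
    set x := b' s - b s
    set y := l' s - l s
    set E := e (l' s) - e (l s) with hE
    set P := β (b' s) - β (b s) with hP
    set Q := β (b' s - l' s) - β (b s - l s) with hQ
    have r1 := quadratic_drift_le M.2 K.2 q1 q2 q3
    have r5 : (e (l' s) / 2 + γ - β (b' s) - (e (l s) / 2 + γ - β (b s))) = E / 2 - P := by
      rw [hE, hP]; ring
    have r6 : (e (l' s) - β (b' s) - β (b' s - l' s)) - (e (l s) - β (b s) - β (b s - l s))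
        = E - P - Q := by
      rw [hE, hP, hQ]; ring
    rw [r6] at q4
    rw [r5]
    refine le_trans ?_ r1
    linarith)
  have h0 := key t ht
  simp only [h.b_zero, h.l_zero, h'.b_zero, h'.l_zero, sub_self, mul_zero, add_zero,
    zero_mul] at h0
  have e1 := mul_self_nonneg (b' t - b t)
  have e2 := mul_self_nonneg (l' t - l t)
  exact ⟨sub_eq_zero.1 (mul_self_eq_zero.1 (by linarith)),
    sub_eq_zero.1 (mul_self_eq_zero.1 (by linarith))⟩

end IsDropFlow

theorem LipschitzWith.abs_le_add {β : ℝ → ℝ} {K : NNReal} (hβ : LipschitzWith K β) (x : ℝ) :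
    |β x| ≤ |β 0| + K * |x| := by
  have h1 := hβ.abs_sub_le x 0
  rw [sub_zero] at h1
  have h2 := abs_sub_abs_le_abs_sub (β x) (β 0)
  linarith

theorem exists_lipschitzOnWith_Icc_of_hasDerivAt {f f' : ℝ → ℝ} {T : ℝ}
    (hf : ∀ t ∈ Icc 0 T, HasDerivAt f (f' t) t) (hf' : ContinuousOn f' (Icc 0 T)) :
    ∃ K, LipschitzOnWith K f (Icc 0 T) := by
  obtain ⟨C, hC⟩ := isCompact_Icc.exists_bound_of_continuousOn hf'
  refine ⟨C.toNNReal, (convex_Icc 0 T).lipschitzOnWith_of_nnnorm_hasDerivWithin_le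
    (fun t ht => (hf t ht).hasDerivWithinAt) fun t ht => ?_⟩
  rw [← NNReal.coe_le_coe, coe_nnnorm]
  exact (hC t ht).trans (Real.le_coe_toNNReal C)

/-- Existence up to time `T`. The law `e` is frozen below a small length `δ`, which makes the
reflected equation globally Lipschitz; in the coordinates `b` and `l` the midpoint of the drop is
`b - l / 2`, and the endpoints at which `β` is evaluated are recomputed from it and the frozen
length. The midpoint then moves at a speed which is bounded independently of `δ` in terms of its
position. This bounds `β` along the motion, so that for small `δ` the blowup of `e` keeps the length
above `δ`, and the frozen law is never used. -/
theorem exists_isDropFlow {e β : ℝ → ℝ} {γ L b₀ l₀ : ℝ} (he : IsSpreadingLaw e L) {K : NNReal}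
    (hβ : LipschitzWith K β) (hl₀ : l₀ ∈ Ioc 0 L) {T : ℝ} (hT : 0 ≤ T) :
    ∃ b l, IsDropFlow e β γ L b₀ l₀ T b l := by
  have hL := he.pos
  have hK0 : (0 : ℝ) ≤ K := K.2
  set C := |e L| / 2 + |γ| + |β 0| + K * L with hC
  set R := (1 + (b₀ - l₀ / 2) * (b₀ - l₀ / 2)) * Real.exp ((C + 2 * K) * T) with hR
  obtain ⟨δ', hδ', hblow⟩ := he.blowup (2 * (|β 0| + K * R) + K * L)
  obtain ⟨δ, hδ, hδl, hδe⟩ : ∃ δ > 0, δ ≤ l₀ ∧ 2 * (|β 0| + K * R) + K * L ≤ e δ :=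
    ⟨min δ' l₀, lt_min hδ' hl₀.1, min_le_right _ _,
      hblow _ ⟨lt_min hδ' hl₀.1, min_le_left _ _⟩⟩
  have hδL : δ ≤ L := hδl.trans hl₀.2
  obtain ⟨M, hM⟩ := he.exists_lipschitzOnWith hδ
  let c : ℝ → ℝ := fun x => max δ (min x L)
  have hcm : ∀ x, c x ∈ Icc δ L := fun x => ⟨le_max_left _ _, max_le hδL (min_le_right _ _)⟩
  have hcl : ∀ x y, |c x - c y| ≤ |x - y| := fun x y => by
    have h1 : LipschitzWith 1 c := (LipschitzWith.id.min_const L).const_max δ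
    simpa using h1.abs_sub_le x y
  have hec : ∀ x y, |e (c x) - e (c y)| ≤ M * |x - y| := fun x y =>
    (hM.dist_le_mul _ (hcm x) _ (hcm y)).trans (mul_le_mul_of_nonneg_left (hcl x y) M.2)
  let N₁ : ℝ → ℝ → ℝ := fun b l => e (c l) / 2 + γ - β (b - l / 2 + c l / 2)
  let N₂ : ℝ → ℝ → ℝ := fun b l => e (c l) - β (b - l / 2 + c l / 2) - β (b - l / 2 - c l / 2)
  have hβ1 : ∀ x y x' y', |β (x - y / 2 + c y / 2) - β (x' - y' / 2 + c y' / 2)|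
      ≤ K * (|x - x'| + |y - y'|) := fun x y x' y' => by
    refine (hβ.abs_sub_le _ _).trans (mul_le_mul_of_nonneg_left ?_ K.2)
    have h1 := hcl y y'
    have h2 := le_abs_self (x - x')
    have h3 := neg_abs_le (x - x')
    have h4 := le_abs_self (y - y')
    have h5 := neg_abs_le (y - y')
    rw [abs_le] at h1 ⊢
    constructor <;> linarith
  have hβ2 : ∀ x y x' y', |β (x - y / 2 - c y / 2) - β (x' - y' / 2 - c y' / 2)|
      ≤ K * (|x - x'| + |y - y'|) := fun x y x' y' => by
    refine (hβ.abs_sub_le _ _).trans (mul_le_mul_of_nonneg_left ?_ K.2)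
    have h1 := hcl y y'
    have h2 := le_abs_self (x - x')
    have h3 := neg_abs_le (x - x')
    have h4 := le_abs_self (y - y')
    have h5 := neg_abs_le (y - y')
    rw [abs_le] at h1 ⊢
    constructor <;> linarith
  have hM0 : (0 : ℝ) < M + 2 * K + 1 := by positivity
  have hN₁ : ∀ x y x' y', |N₁ x y - N₁ x' y'| ≤ (M + 2 * K + 1) * (|x - x'| + |y - y'|) :=
    fun x y x' y' => by
      have h1 := hec y y'
      have h2 := hβ1 x y x' y'
      have h3 : 0 ≤ (M : ℝ) * |x - x'| := by positivity
      have h4 : 0 ≤ (K : ℝ) * (|x - x'| + |y - y'|) := by positivity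
      have h5 : 0 ≤ (M : ℝ) * |y - y'| := by positivity
      have h6 := abs_nonneg (x - x')
      have h7 := abs_nonneg (y - y')
      simp only [N₁]
      rw [abs_le] at *
      constructor <;> linarith
  have hN₂ : ∀ x y x' y', |N₂ x y - N₂ x' y'| ≤ (M + 2 * K + 1) * (|x - x'| + |y - y'|) :=
    fun x y x' y' => by
      have h1 := hec y y'
      have h2 := hβ1 x y x' y'
      have h8 := hβ2 x y x' y'
      have h3 : 0 ≤ (M : ℝ) * |x - x'| := by positivity
      have h6 := abs_nonneg (x - x')
      have h7 := abs_nonneg (y - y')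
      simp only [N₂]
      rw [abs_le] at h1 h2 h8 ⊢
      constructor <;> linarith
  obtain ⟨b, Y, hb0, hY0, hYc, hODE⟩ := exists_reflected_solution hM0 hN₁ hN₂ b₀ l₀ L
  set S := runningExcess L Y with hS
  have hSc : Continuous S := continuous_runningExcess hYc
  set l : ℝ → ℝ := fun t => Y t - S t with hl
  have hl0 : l 0 = l₀ := by
    simp only [hl, hS]
    rw [runningExcess_zero (hY0.trans_le hl₀.2), hY0, sub_zero]
  have hlL : ∀ t, 0 ≤ t → l t ≤ L := fun t ht => by
    have := sub_le_runningExcess (L := L) hYc (right_mem_Icc.2 ht)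
    simp only [hl, hS]
    linarith
  have hlc : Continuous l := hYc.sub hSc
  have hbc : ContinuousOn b (Icc 0 T) := fun t ht =>
    (hODE t ht.1).1.continuousAt.continuousWithinAt
  have hβc := hβ.continuous
  have hcc : Continuous c := by fun_prop
  have hecc : Continuous fun x => e (c x) :=
    (LipschitzWith.of_dist_le_mul (K := M) fun x y => hec x y).continuous
  have hecl : ContinuousOn (fun t => e (c (l t))) (Icc 0 T) := (hecc.comp hlc).continuousOn
  have hβ1c : ContinuousOn (fun t => β (b t - l t / 2 + c (l t) / 2)) (Icc 0 T) :=
    hβc.comp_continuousOn (by fun_prop)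
  have hβ2c : ContinuousOn (fun t => β (b t - l t / 2 - c (l t) / 2)) (Icc 0 T) :=
    hβc.comp_continuousOn (by fun_prop)
  have hbl : ∃ K, LipschitzOnWith K b (Icc 0 T) :=
    exists_lipschitzOnWith_Icc_of_hasDerivAt (f' := fun t => N₁ (b t) (l t))
      (fun t ht => (hODE t ht.1).1) (((hecl.div_const 2).add continuousOn_const).sub hβ1c)
  obtain ⟨KY, hKY⟩ : ∃ K, LipschitzOnWith K Y (Icc 0 T) :=
    exists_lipschitzOnWith_Icc_of_hasDerivAt (f' := fun t => N₂ (b t) (l t))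
      (fun t ht => (hODE t ht.1).2) ((hecl.sub hβ1c).sub hβ2c)
  have hSl : LipschitzOnWith KY S (Icc 0 T) := runningExcess_lipschitzOnWith hYc hKY
  have hll : LipschitzOnWith (KY + KY) l (Icc 0 T) := hKY.sub hSl
  have hlac := hll.absolutelyContinuousOnInterval_of_le hT
  have hbac : AbsolutelyContinuousOnInterval b 0 T := by
    obtain ⟨_, h⟩ := hbl
    exact h.absolutelyContinuousOnInterval_of_le hT
  have hfree : ∀ t, 0 < t → l t < L → HasDerivAt l (N₂ (b t) (l t)) t := by
    intro t ht hlt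
    have h1 : HasDerivAt S 0 t :=
      (hasDerivAt_const t (S t)).congr_of_eventuallyEq (runningExcess_eventuallyEq hYc ht hlt)
    simpa using (hODE t ht.le).2.fun_sub h1
  have hdl : ∀ᵐ t, t ∈ Ioo 0 T → DifferentiableAt ℝ l t := hlac.ae_differentiableAt_Ioo
  have hle : ∀ᵐ t, t ∈ Ioo 0 T → deriv l t ≤ N₂ (b t) (l t) := by
    filter_upwards [hdl] with t h1 ht
    have h2 := (hODE t ht.1.le).2
    have h3 : HasDerivAt S (N₂ (b t) (l t) - deriv l t) t := by
      have := h2.fun_sub (h1 ht).hasDerivAt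
      simpa [hl] using this
    have h4 : 0 ≤ derivWithin S (Icc 0 T) t :=
      MonotoneOn.derivWithin_nonneg fun s hs r _ hsr => runningExcess_mono hYc hs.1 hsr
    rw [derivWithin_of_mem_nhds (Icc_mem_nhds ht.1 ht.2), h3.deriv] at h4
    linarith
  have hrigid : ∀ t, 0 < t → l t = L → deriv l t = 0 := by
    intro t ht h
    refine IsLocalMax.deriv_eq_zero ?_
    filter_upwards [Ioi_mem_nhds ht] with s hs
    rw [h]
    exact hlL s (le_of_lt hs)
  -- the midpoint
  set m : ℝ → ℝ := fun t => b t - l t / 2 with hm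
  have hmac : AbsolutelyContinuousOnInterval m 0 T := by
    have := hbac.fun_sub (hlac.const_mul (1 / 2))
    refine (congrArg (fun f => AbsolutelyContinuousOnInterval f 0 T) ?_).mp this
    funext t
    simp only [hm]
    ring
  have hmd : ∀ᵐ t, t ∈ Ioo 0 T → DifferentiableAt ℝ m t ∧ |deriv m t| ≤ C + K * |m t| := by
    filter_upwards [hdl] with t h1 ht
    have hb1 := (hODE t ht.1.le).1
    have hm1 : HasDerivAt m (N₁ (b t) (l t) - deriv l t / 2) t :=
      hb1.fun_sub ((h1 ht).hasDerivAt.div_const 2)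
    refine ⟨hm1.differentiableAt, ?_⟩
    rw [hm1.deriv]
    have p1 : 0 ≤ K * |m t| := by positivity
    have p2 : 0 ≤ K * L := by positivity
    have p3 := abs_nonneg (e L)
    have p4 := abs_nonneg (β 0)
    have p5 := le_abs_self γ
    have p6 := neg_abs_le γ
    rcases (hlL t ht.1.le).lt_or_eq with hlt | heq
    · rw [(hfree t ht.1 hlt).deriv]
      have h2 := hβ.abs_sub_le (m t + c (l t) / 2) (m t - c (l t) / 2)
      have h3 : (K : ℝ) * |m t + c (l t) / 2 - (m t - c (l t) / 2)| ≤ K * L := by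
        refine mul_le_mul_of_nonneg_left ?_ K.2
        rw [show m t + c (l t) / 2 - (m t - c (l t) / 2) = c (l t) by ring,
          abs_of_nonneg (hδ.le.trans (hcm _).1)]
        exact (hcm _).2
      have h4 : N₁ (b t) (l t) - N₂ (b t) (l t) / 2
          = γ - (β (m t + c (l t) / 2) - β (m t - c (l t) / 2)) / 2 := by
        simp only [N₁, N₂, hm]
        ring
      rw [h4]
      have h5 := abs_le.1 (h2.trans h3)
      rw [abs_le]
      constructor <;> linarith
    · rw [hrigid t ht.1 heq, zero_div, sub_zero]
      have h2 : c (l t) = L := by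
        simp only [c]
        rw [heq, min_self, max_eq_right hδL]
      have h3 : N₁ (b t) (l t) = e L / 2 + γ - β (m t + L / 2) := by
        simp only [N₁, hm, h2]
      have h4 := hβ.abs_le_add (m t + L / 2)
      have h5 : (K : ℝ) * |m t + L / 2| ≤ K * (|m t| + L / 2) := by
        refine mul_le_mul_of_nonneg_left ((abs_add_le _ _).trans ?_) K.2
        rw [abs_of_nonneg (show 0 ≤ L / 2 by linarith)]
      rw [h3]
      have h6 := abs_le.1 (h4.trans (add_le_add_right h5 _))
      have h7 := le_abs_self (e L)
      have h8 := neg_abs_le (e L)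
      rw [abs_le]
      constructor <;> linarith
  have hmR : ∀ t ∈ Icc 0 T, |m t| ≤ R := by
    intro t ht
    have hone : AbsolutelyContinuousOnInterval (fun _ : ℝ => (1 : ℝ)) 0 T :=
      ContDiffOn.absolutelyContinuousOnInterval (by fun_prop)
    have hC0 : 0 ≤ C := by positivity
    have h1 := (hone.fun_add (hmac.fun_mul hmac)).gronwall (c := C + 2 * K) (by
      filter_upwards [hmd] with s h1 hs
      obtain ⟨h2, h3⟩ := h1 hs
      rw [((h2.hasDerivAt.fun_mul h2.hasDerivAt).const_add 1).deriv]
      have h4 : deriv m s * m s ≤ (C + K * |m s|) * |m s| := by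
        refine (le_abs_self _).trans ?_
        rw [abs_mul]
        exact mul_le_mul_of_nonneg_right h3 (abs_nonneg _)
      rw [← abs_mul_abs_self (m s)]
      have h5 : |m s| ≤ (1 + |m s| * |m s|) / 2 := by nlinarith [sq_nonneg (|m s| - 1)]
      have h6 := mul_le_mul_of_nonneg_left h5 hC0
      have h7 : (0 : ℝ) ≤ K * 2 := by positivity
      linarith) t ht
    have h2 : m 0 = b₀ - l₀ / 2 := by simp only [hm, hb0, hl0]
    rw [h2] at h1
    have h3 : Real.exp ((C + 2 * K) * t) ≤ Real.exp ((C + 2 * K) * T) :=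
      Real.exp_le_exp.2 (mul_le_mul_of_nonneg_left ht.2 (by positivity))
    have h4 : (1 + (b₀ - l₀ / 2) * (b₀ - l₀ / 2)) * Real.exp ((C + 2 * K) * t) ≤ R :=
      mul_le_mul_of_nonneg_left h3 (by nlinarith [mul_self_nonneg (b₀ - l₀ / 2)])
    have h5 : |m t| ≤ 1 + m t * m t := by
      rw [← abs_mul_abs_self (m t)]
      nlinarith [sq_nonneg (|m t| - 1), sq_nonneg (|m t|)]
    linarith
  have hlδ : ∀ t ∈ Icc 0 T, δ ≤ l t := by
    refine hlac.barrier (hδl.trans_eq hl0.symm) ?_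
    refine Filter.Eventually.of_forall fun t ht hlt => ?_
    rw [(hfree t ht.1 (hlt.trans_le hδL)).deriv]
    have h1 : c (l t) = δ := max_eq_left ((min_le_left _ _).trans hlt.le)
    have h2 : N₂ (b t) (l t) = e δ - β (m t + δ / 2) - β (m t - δ / 2) := by
      simp only [N₂, hm, h1]
    have h3 := hmR t (Ioo_subset_Icc_self ht)
    have h4 : ∀ x, |x| ≤ R + L / 2 → β x ≤ |β 0| + K * (R + L / 2) := fun x hx =>
      (le_abs_self _).trans ((hβ.abs_le_add x).trans
        (add_le_add_right (mul_le_mul_of_nonneg_left hx K.2) _))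
    have h5 := h4 (m t + δ / 2) (by rw [abs_le] at *; constructor <;> linarith)
    have h6 := h4 (m t - δ / 2) (by rw [abs_le] at *; constructor <;> linarith)
    rw [h2]
    linarith
  have hcl' : ∀ t ∈ Icc 0 T, c (l t) = l t := fun t ht => by
    simp only [c]
    rw [min_eq_left (hlL t ht.1), max_eq_right (hlδ t ht)]
  have hN₁' : ∀ t ∈ Icc 0 T, N₁ (b t) (l t) = e (l t) / 2 + γ - β (b t) := fun t ht => by
    simp only [N₁, hcl' t ht, sub_add_cancel]
  have hN₂' : ∀ t ∈ Icc 0 T, N₂ (b t) (l t) = e (l t) - β (b t) - β (b t - l t) := fun t ht => by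
    simp only [N₂, hcl' t ht, sub_add_cancel]
    rw [show b t - l t / 2 - l t / 2 = b t - l t by ring]
  refine ⟨b, l, hbl, ⟨_, hll⟩, hb0, hl0, fun t ht => ⟨hδ.trans_le (hlδ t ht), hlL t ht.1⟩,
    Filter.Eventually.of_forall fun t ht => ?_, ?_, Filter.Eventually.of_forall fun t ht hlt => ?_⟩
  · rw [← hN₁' t (Ioo_subset_Icc_self ht)]
    exact (hODE t ht.1.le).1.deriv
  · filter_upwards [hle] with t h1 ht
    rw [← hN₂' t (Ioo_subset_Icc_self ht)]
    exact h1 ht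
  · rw [← hN₂' t (Ioo_subset_Icc_self ht)]
    exact (hfree t ht.1 hlt).deriv

theorem exists_isDropFlow_forall {e β : ℝ → ℝ} {γ L b₀ l₀ : ℝ} (he : IsSpreadingLaw e L)
    {K : NNReal} (hβ : LipschitzWith K β) (hl₀ : l₀ ∈ Ioc 0 L) :
    ∃ b l, ∀ T, 0 ≤ T → IsDropFlow e β γ L b₀ l₀ T b l := by
  have hex : ∀ n : ℕ, ∃ q : (ℝ → ℝ) × (ℝ → ℝ), IsDropFlow e β γ L b₀ l₀ n q.1 q.2 := fun n => by
    obtain ⟨b, l, h⟩ := exists_isDropFlow (γ := γ) (b₀ := b₀) he hβ hl₀ (Nat.cast_nonneg n)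
    exact ⟨(b, l), h⟩
  choose q hq using hex
  refine ⟨fun t => (q ⌈t⌉₊).1 t, fun t => (q ⌈t⌉₊).2 t, fun T hT => ?_⟩
  have key : ∀ t ∈ Icc 0 T, (q ⌈t⌉₊).1 t = (q ⌈T⌉₊).1 t ∧ (q ⌈t⌉₊).2 t = (q ⌈T⌉₊).2 t :=
    fun t ht => IsDropFlow.unique he hβ ((hq ⌈T⌉₊).mono (ht.2.trans (Nat.le_ceil T)))
      ((hq ⌈t⌉₊).mono (Nat.le_ceil t)) t ⟨ht.1, le_rfl⟩
  exact ((hq ⌈T⌉₊).mono (Nat.le_ceil T)).congr hT (fun t ht => (key t ht).1)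
    fun t ht => (key t ht).2

/-- If `β` is bounded below, the endpoints move at bounded speed. In free motion the midpoint
does because the difference of the two driving terms is constant and `β` is Lipschitz; rigid motion
at maximal length is possible only where `β` is bounded above in terms of `e L`. Hence `β` at the
midpoint varies at a bounded rate along the motion, and since `e` decreases, the excess
`e l - 2 β (b - l / 2) - l` is driven back whenever it is large of either sign; so it stays bounded,
and it controls the speed of `b`. -/
theorem IsDropFlow.exists_lipschitzOnWith_Ici {e β : ℝ → ℝ} {γ L b₀ l₀ : ℝ}
    (he : IsSpreadingLaw e L) {K : NNReal} (hβ : LipschitzWith K β) {B₀ : ℝ} (hB : ∀ x, -B₀ ≤ β x)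
    {b l : ℝ → ℝ} (h : ∀ T, 0 ≤ T → IsDropFlow e β γ L b₀ l₀ T b l) :
    ∃ K, LipschitzOnWith K (fun t => b t - l t) (Ici 0) ∧ LipschitzOnWith K b (Ici 0) := by
  have hL := he.pos
  have hlip : ∀ {f : ℝ → ℝ}, (∀ T, 0 ≤ T → ∃ K, LipschitzOnWith K f (Icc 0 T)) →
      ∀ T, ∃ K, LipschitzOnWith K f (Icc 0 T) := fun {f} hf T => by
    rcases le_total 0 T with hT | hT
    · exact hf T hT
    · obtain ⟨M, hM⟩ := hf 0 le_rfl
      exact ⟨M, hM.mono (Icc_subset_Icc_right hT)⟩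
  have hbl := hlip fun T hT => (h T hT).lipschitz_b
  have hll := hlip fun T hT => (h T hT).lipschitz_l
  have hmem : ∀ t, 0 ≤ t → l t ∈ Ioc 0 L := fun t ht => (h t ht).mem t ⟨ht, le_rfl⟩
  have hreg : ∀ᵐ t, 0 < t → DifferentiableAt ℝ b t ∧ DifferentiableAt ℝ l t ∧
      deriv b t = e (l t) / 2 + γ - β (b t) ∧
      ((l t < L ∧ deriv l t = e (l t) - β (b t) - β (b t - l t)) ∨
        (l t = L ∧ deriv l t = 0 ∧ 0 ≤ e (l t) - β (b t) - β (b t - l t))) := by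
    have h1 : ∀ᵐ t, ∀ n : ℕ, t ∈ Ioo 0 (n : ℝ) → _ :=
      ae_all_iff.2 fun n : ℕ => (h n (Nat.cast_nonneg n)).ae_regime
    filter_upwards [h1] with t h2 ht
    obtain ⟨n, hn⟩ := exists_nat_gt t
    exact h2 n ⟨ht, hn⟩
  set m : ℝ → ℝ := fun t => b t - l t / 2 with hm
  have hml : ∀ T, ∃ K, LipschitzOnWith K m (Icc 0 T) := fun T => by
    obtain ⟨K₁, h₁⟩ := hbl T
    obtain ⟨K₂, h₂⟩ := hll T
    refine ⟨K₁ + K₂, LipschitzOnWith.of_dist_le_mul fun s hs t ht => ?_⟩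
    have e1 := h₁.dist_le_mul s hs t ht
    have e2 := h₂.dist_le_mul s hs t ht
    have e3 : 0 ≤ (K₂ : ℝ) * dist s t := by positivity
    simp only [hm]
    push_cast
    rw [Real.dist_eq] at *
    rw [abs_le] at *
    constructor <;> linarith
  have hKL : 0 ≤ K * L := by positivity
  set M₁ : NNReal := ⟨2 * |e L| + |γ| + K * L + |B₀|, by positivity⟩ with hM₁
  have hM₁v : (M₁ : ℝ) = 2 * |e L| + |γ| + K * L + |B₀| := rfl
  have a1 := le_abs_self (e L)
  have a2 := neg_abs_le (e L)
  have a3 := le_abs_self γ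
  have a4 := neg_abs_le γ
  have a5 := le_abs_self B₀
  have a6 := abs_nonneg (e L)
  have hmd : ∀ᵐ t, 0 < t → |deriv m t| ≤ M₁ := by
    filter_upwards [hreg] with t h1 ht
    obtain ⟨db, dl, eb, hl⟩ := h1 ht
    have hm1 : HasDerivAt m (deriv b t - deriv l t / 2) t :=
      db.hasDerivAt.fun_sub (dl.hasDerivAt.div_const 2)
    rw [hm1.deriv, eb, hM₁v]
    rcases hl with ⟨g1, g2⟩ | ⟨g1, g2, g3⟩
    · have h2 := hβ.abs_sub_le (b t) (b t - l t)
      rw [sub_sub_cancel, abs_of_pos (hmem t ht.le).1] at h2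
      have h3 : (K : ℝ) * l t ≤ K * L := mul_le_mul_of_nonneg_left (hmem t ht.le).2 K.2
      have h4 := abs_le.1 (h2.trans h3)
      have h5 := abs_nonneg B₀
      rw [g2, abs_le]
      constructor <;> linarith
    · have h2 := hB (b t)
      have h3 := hB (b t - l t)
      rw [g1] at g3 h3
      rw [g2, g1, abs_le]
      constructor <;> linarith
  have hmL : LipschitzOnWith M₁ m (Ici 0) := lipschitzOnWith_Ici_of_ae_deriv_le hml hmd
  have hβmL : LipschitzOnWith (K * M₁) (fun t => β (m t)) (Ici 0) :=
    hβ.comp_lipschitzOnWith hmL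
  have hβmd : ∀ t, 0 < t → |deriv (fun t => β (m t)) t| ≤ K * M₁ := fun t ht => by
    have := norm_deriv_le_of_lipschitzOn (Ici_mem_nhds ht) hβmL
    simpa using this
  set Z : ℝ → ℝ := fun t => e (l t) - 2 * β (m t) - l t with hZ
  have hZac : ∀ T, 0 ≤ T → AbsolutelyContinuousOnInterval Z 0 T := fun T hT => by
    obtain ⟨δ, hδ, hlδ⟩ := (h T hT).exists_pos_le hT
    obtain ⟨M, hM⟩ := he.exists_lipschitzOnWith hδ
    obtain ⟨K₂, h₂⟩ := hll T
    have e1 := (hM.comp h₂ fun t ht =>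
      (⟨hlδ t ht, (hmem t ht.1).2⟩ : l t ∈ Icc δ L)).absolutelyContinuousOnInterval_of_le hT
    have e2 := ((hβmL.mono Icc_subset_Ici_self).absolutelyContinuousOnInterval_of_le
      hT).const_mul 2
    exact (e1.fun_sub e2).fun_sub (h₂.absolutelyContinuousOnInterval_of_le hT)
  have hZd : ∀ᵐ t, 0 < t → ∃ g ≤ 0, ∃ d : ℝ, |d| ≤ 2 * (K * M₁) ∧
      deriv Z t = g * deriv l t - d - deriv l t := by
    have h1 : ∀ᵐ t, ∀ n : ℕ, t ∈ Ioo 0 (n : ℝ) → DifferentiableAt ℝ (fun t => β (m t)) t :=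
      ae_all_iff.2 fun n : ℕ => ((hβmL.mono
        Icc_subset_Ici_self).absolutelyContinuousOnInterval_of_le
          (Nat.cast_nonneg n)).ae_differentiableAt_Ioo
    filter_upwards [hreg, h1] with t h2 h3 ht
    obtain ⟨n, hn⟩ := exists_nat_gt t
    have h4 := h3 n ⟨ht, hn⟩
    obtain ⟨db, dl, -⟩ := h2 ht
    have h5 : HasDerivAt e (deriv e (l t)) (l t) :=
      (he.differentiableAt (hmem t ht.le).1).hasDerivAt
    have h6 := ((h5.comp t dl.hasDerivAt).fun_sub (h4.hasDerivAt.const_mul 2)).fun_sub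
      dl.hasDerivAt
    refine ⟨deriv e (l t), he.deriv_nonpos _ (hmem t ht.le),
      2 * deriv (fun t => β (m t)) t, ?_, h6.deriv⟩
    rw [abs_mul, abs_of_pos (two_pos : (0 : ℝ) < 2)]
    exact mul_le_mul_of_nonneg_left (hβmd t ht) two_pos.le
  -- `Z + l` is the speed of the free length, up to a bounded error
  have hspeed : ∀ t, 0 ≤ t →
      |e (l t) - β (b t) - β (b t - l t) - (Z t + l t)| ≤ K * L := fun t ht => by
    have h1 := hβ.abs_add_sub_two_mul_le (hmem t ht).1.le (b t)
    have h2 : (K : ℝ) * l t ≤ K * L := mul_le_mul_of_nonneg_left (hmem t ht).2 K.2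
    have h3 := abs_le.1 (h1.trans h2)
    simp only [hZ, hm]
    rw [abs_le]
    constructor <;> linarith
  set M₃ := max |Z 0| (|e L| + 2 * |B₀| + 2 * (K * M₁) + L + K * L + 1) with hM₃
  have b1 : |e L| + 2 * |B₀| + 2 * (K * M₁) + L + K * L + 1 ≤ M₃ := le_max_right _ _
  have b2 := abs_le.1 (le_max_left |Z 0| (|e L| + 2 * |B₀| + 2 * (K * M₁) + L + K * L + 1))
  have b3 := abs_nonneg B₀
  have b4 : (0 : ℝ) ≤ 2 * (K * M₁) := by positivity
  have hZlow : ∀ t, 0 ≤ t → -M₃ ≤ Z t := by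
    intro t ht
    refine (hZac t ht).barrier b2.1 ?_ t ⟨ht, le_rfl⟩
    filter_upwards [hreg, hZd] with s h1 h2 hs hlt
    obtain ⟨-, -, -, hl⟩ := h1 hs.1
    obtain ⟨g, hg, d, hd, hZ'⟩ := h2 hs.1
    have c1 := abs_le.1 (hspeed s hs.1.le)
    have c2 := (hmem s hs.1.le).2
    have c3 := abs_le.1 hd
    rcases hl with ⟨g1, g2⟩ | ⟨g1, g2, g3⟩
    · have c4 : deriv l s ≤ -(2 * (K * M₁)) := by
        rw [g2]
        linarith
      have c5 : 0 ≤ g * deriv l s := mul_nonneg_of_nonpos_of_nonpos hg (by linarith)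
      rw [hZ']
      linarith
    · linarith
  have hZup : ∀ t, 0 ≤ t → Z t ≤ M₃ := by
    intro t ht
    have hneg := (hZac t ht).const_mul (-1)
    have := hneg.barrier (c := -M₃) (by linarith [b2.2]) (by
      filter_upwards [hreg, hZd] with s h1 h2 hs hlt
      obtain ⟨-, -, -, hl⟩ := h1 hs.1
      obtain ⟨g, hg, d, hd, hZ'⟩ := h2 hs.1
      have c1 := abs_le.1 (hspeed s hs.1.le)
      have c2 := (hmem s hs.1.le).1
      have c3 := abs_le.1 hd
      rcases hl with ⟨g1, g2⟩ | ⟨g1, g2, g3⟩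
      · have c4 : 2 * (K * M₁) ≤ deriv l s := by
          rw [g2]
          linarith
        have c5 : g * deriv l s ≤ 0 := mul_nonpos_of_nonpos_of_nonneg hg (by linarith)
        rw [deriv_const_mul_field, hZ']
        linarith
      · exfalso
        have c4 : Z s = e L - 2 * β (m s) - L := by simp only [hZ, g1]
        have c5 := hB (m s)
        linarith) t ⟨ht, le_rfl⟩
    linarith
  set M₄ : NNReal := ⟨(M₃ + L) / 2 + |γ| + K * L, by
    have : 0 ≤ M₃ := (abs_nonneg _).trans (le_max_left _ _)
    positivity⟩ with hM₄
  have hM₄v : (M₄ : ℝ) = (M₃ + L) / 2 + |γ| + K * L := rfl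
  have hbL : LipschitzOnWith M₄ b (Ici 0) := by
    refine lipschitzOnWith_Ici_of_ae_deriv_le hbl ?_
    filter_upwards [hreg] with t h1 ht
    obtain ⟨-, -, eb, -⟩ := h1 ht
    have c1 := hβ.abs_sub_le (m t) (b t)
    have c2 := hmem t ht.le
    have c3 : (K : ℝ) * |m t - b t| ≤ K * L := by
      refine mul_le_mul_of_nonneg_left ?_ K.2
      simp only [hm]
      rw [abs_le]
      constructor <;> linarith [c2.1, c2.2]
    have c4 := abs_le.1 (c1.trans c3)
    have c5 : e (l t) / 2 + γ - β (b t) = (Z t + l t) / 2 + γ + (β (m t) - β (b t)) := by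
      simp only [hZ]
      ring
    rw [eb, c5, hM₄v, abs_le]
    have c6 := hZlow t ht.le
    have c7 := hZup t ht.le
    constructor <;> linarith [c2.1, c2.2]
  refine ⟨2 * M₁ + M₄, LipschitzOnWith.of_dist_le_mul fun s hs t ht => ?_,
    hbL.weaken (le_add_of_nonneg_left (by positivity))⟩
  have c1 := hbL.dist_le_mul s hs t ht
  have c2 := hmL.dist_le_mul s hs t ht
  simp only [hm] at c2
  push_cast
  rw [Real.dist_eq] at *
  have c3 := abs_le.1 c1
  have c4 := abs_le.1 c2
  rw [abs_le]
  constructor <;> linarith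

/-! ### The function `z coth z - 1` -/

/-- `z coth z - 1`, through which the slopes of a drop depend on its length. -/
noncomputable def cothGap (z : ℝ) : ℝ := z * Real.cosh z / Real.sinh z - 1

theorem sinh_lt_mul_cosh {z : ℝ} (hz : 0 < z) : Real.sinh z < z * Real.cosh z := by
  have hd : ∀ x, HasDerivAt (fun z => z * Real.cosh z - Real.sinh z) (x * Real.sinh x) x :=
    fun x => by
      have := ((hasDerivAt_id' x).fun_mul (Real.hasDerivAt_cosh x)).fun_sub
        (Real.hasDerivAt_sinh x)
      refine this.congr_deriv ?_
      ring
  have hmono : StrictMonoOn (fun z => z * Real.cosh z - Real.sinh z) (Ici 0) := by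
    refine strictMonoOn_of_deriv_pos (convex_Ici 0)
      (fun x _ => (hd x).continuousAt.continuousWithinAt) fun x hx => ?_
    rw [interior_Ici] at hx
    rw [(hd x).deriv]
    exact mul_pos hx (Real.sinh_pos_iff.2 hx)
  simpa using hmono (mem_Ici.2 le_rfl) (mem_Ici.2 hz.le) hz

theorem lt_sinh_mul_cosh {z : ℝ} (hz : 0 < z) : z < Real.sinh z * Real.cosh z := by
  have h1 := Real.self_le_sinh_iff.2 hz.le
  have h2 := Real.one_lt_cosh.2 hz.ne'
  have h3 := Real.sinh_pos_iff.2 hz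
  nlinarith

theorem cothGap_eq {z : ℝ} (hz : 0 < z) :
    cothGap z = (z * Real.cosh z - Real.sinh z) / Real.sinh z := by
  have := (Real.sinh_pos_iff.2 hz).ne'
  unfold cothGap
  field_simp

theorem cothGap_pos {z : ℝ} (hz : 0 < z) : 0 < cothGap z := by
  rw [cothGap_eq hz]
  exact div_pos (sub_pos.2 (sinh_lt_mul_cosh hz)) (Real.sinh_pos_iff.2 hz)

theorem hasDerivAt_cothGap {z : ℝ} (hz : 0 < z) :
    HasDerivAt cothGap ((Real.sinh z * Real.cosh z - z) / Real.sinh z ^ 2) z := by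
  have hs := (Real.sinh_pos_iff.2 hz).ne'
  have h := (((hasDerivAt_id' z).fun_mul (Real.hasDerivAt_cosh z)).fun_div
    (Real.hasDerivAt_sinh z) hs).sub_const 1
  refine h.congr_deriv ?_
  congr 1
  have := Real.cosh_sq z
  linear_combination (-z) * this

theorem contDiffOn_cothGap : ContDiffOn ℝ 1 cothGap (Ioi 0) := by
  unfold cothGap
  refine ContDiffOn.sub (ContDiffOn.div (by fun_prop) (by fun_prop) fun x hx => ?_) (by fun_prop)
  exact (Real.sinh_pos_iff.2 hx).ne'

theorem strictMonoOn_cothGap : StrictMonoOn cothGap (Ioi 0) := by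
  refine strictMonoOn_of_deriv_pos (convex_Ioi 0) contDiffOn_cothGap.continuousOn fun x hx => ?_
  rw [interior_Ioi] at hx
  rw [(hasDerivAt_cothGap hx).deriv]
  exact div_pos (sub_pos.2 (lt_sinh_mul_cosh hx)) (pow_pos (Real.sinh_pos_iff.2 hx) 2)

theorem exists_cothGap_le {ε : ℝ} (hε : 0 < ε) : ∃ δ > 0, ∀ z ∈ Ioc 0 δ, cothGap z ≤ ε := by
  have h1 : ∀ᶠ z in nhds 0, Real.cosh z < 1 + ε :=
    Real.continuous_cosh.continuousAt.eventually_lt continuousAt_const (by simp [hε])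
  obtain ⟨δ, hδ, hball⟩ := Metric.eventually_nhds_iff.1 h1
  refine ⟨δ / 2, half_pos hδ, fun z hz => ?_⟩
  have h2 : Real.cosh z < 1 + ε := hball (by
    rw [Real.dist_eq, sub_zero, abs_of_pos hz.1]
    linarith [hz.2])
  have h3 := Real.self_le_sinh_iff.2 hz.1.le
  have h4 := Real.sinh_pos_iff.2 hz.1
  have h5 : z * Real.cosh z / Real.sinh z ≤ Real.cosh z := by
    rw [div_le_iff₀ h4, mul_comm]
    exact mul_le_mul_of_nonneg_left h3 (Real.cosh_pos z).le
  unfold cothGap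
  linarith

theorem exists_cothGap_eq {y : ℝ} (hy : 0 < y) : ∃ z > 0, cothGap z = y := by
  obtain ⟨δ, hδ, h⟩ := exists_cothGap_le hy
  have h1 : cothGap δ ≤ y := h δ ⟨hδ, le_rfl⟩
  have h2 : y ≤ cothGap (y + 1) := by
    have hp : 0 < Real.sinh (y + 1) := Real.sinh_pos_iff.2 (by linarith)
    have h3 : y + 1 ≤ (y + 1) * Real.cosh (y + 1) / Real.sinh (y + 1) := by
      rw [le_div_iff₀ hp]
      exact mul_le_mul_of_nonneg_left (Real.sinh_lt_cosh _).le (by linarith)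
    unfold cothGap
    linarith
  obtain ⟨z, hz, he⟩ := isPreconnected_Ioi.intermediate_value (mem_Ioi.2 hδ)
    (mem_Ioi.2 (by linarith : (0 : ℝ) < y + 1)) contDiffOn_cothGap.continuousOn ⟨h1, h2⟩
  exact ⟨z, hz, he⟩

/-- The sum of the driving terms at the two endpoints of a drop of length `l`. -/
noncomputable def spreadingLaw (k C D l : ℝ) : ℝ :=
  (C / cothGap (k * l / 2)) ^ 2 + (D * cothGap (k * l / 2)) ^ 2

theorem isSpreadingLaw_spreadingLaw {k C D L : ℝ} (hk : 0 < k) (hC : 0 < C) (hD : 0 < D)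
    (hL : 0 < L) (hLeq : cothGap (k * L / 2) ^ 2 = C / D) :
    IsSpreadingLaw (spreadingLaw k C D) L := by
  have hmem : ∀ {x : ℝ}, 0 < x → 0 < k * x / 2 := fun hx => by positivity
  refine ⟨hL, ?_, fun x hx => ?_, fun R => ?_⟩
  · have h1 : ContDiffOn ℝ 1 (fun l => cothGap (k * l / 2)) (Ioi 0) :=
      contDiffOn_cothGap.comp (by fun_prop) fun x hx => hmem hx
    unfold spreadingLaw
    refine ContDiffOn.add (ContDiffOn.pow (ContDiffOn.div (by fun_prop) h1 fun x hx => ?_) 2)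
      (ContDiffOn.pow (ContDiffOn.mul (by fun_prop) h1) 2)
    exact (cothGap_pos (hmem hx)).ne'
  · have hx0 := hmem hx.1
    have hg := cothGap_pos hx0
    obtain ⟨g', hg', hd⟩ : ∃ g' ≥ 0, HasDerivAt (fun l => cothGap (k * l / 2)) g' x := by
      have h1 : HasDerivAt (fun l => k * l / 2) (k * 1 / 2) x :=
        ((hasDerivAt_id' x).const_mul k).div_const 2
      refine ⟨_, ?_, HasDerivAt.comp x (hasDerivAt_cothGap hx0) h1⟩
      have h2 := lt_sinh_mul_cosh hx0
      exact mul_nonneg (div_nonneg (by linarith) (sq_nonneg _)) (by positivity)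
    have h3 := (((hasDerivAt_const x C).fun_div hd hg.ne').fun_pow 2).fun_add
      ((hd.const_mul D).fun_pow 2)
    have h4 : cothGap (k * x / 2) ≤ cothGap (k * L / 2) :=
      strictMonoOn_cothGap.monotoneOn hx0 (hmem hL) (by
        have := mul_le_mul_of_nonneg_left hx.2 hk.le
        linarith)
    have h5 : deriv (spreadingLaw k C D) x = _ := h3.deriv
    rw [h5]
    set g := cothGap (k * x / 2)
    have h6 : g ^ 2 ≤ C / D := hLeq ▸ pow_le_pow_left₀ hg.le h4 2
    rw [le_div_iff₀ hD] at h6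
    have h7 : (g ^ 2 * D) ^ 2 ≤ C ^ 2 := pow_le_pow_left₀ (by positivity) h6 2
    have h8 : ((2 : ℕ) * (C / g) ^ (2 - 1) * ((0 * g - C * g') / g ^ 2)
        + (2 : ℕ) * (D * g) ^ (2 - 1) * (D * g')) = 2 * g' / g ^ 3 * ((g ^ 2 * D) ^ 2 - C ^ 2) := by
      push_cast
      field_simp
      ring
    rw [h8]
    exact mul_nonpos_of_nonneg_of_nonpos (by positivity) (by linarith)
  · obtain ⟨δ, hδ, h⟩ := exists_cothGap_le (ε := C / (|R| + 1)) (by positivity)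
    refine ⟨2 * δ / k, by positivity, fun x hx => ?_⟩
    have h1 : k * x / 2 ∈ Ioc 0 δ := by
      refine ⟨hmem hx.1, ?_⟩
      have := (le_div_iff₀ hk).1 hx.2
      linarith
    have h2 := h _ h1
    have hg := cothGap_pos h1.1
    have h3 : |R| + 1 ≤ C / cothGap (k * x / 2) := by
      rw [le_div_iff₀ (by positivity)] at h2
      rw [le_div_iff₀ hg]
      linarith
    have h4 := le_abs_self R
    have h5 := abs_nonneg R
    unfold spreadingLaw
    nlinarith [sq_nonneg (D * cothGap (k * x / 2))]

/-! ### The profile of a drop -/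

/-- The solution of the Euler-Lagrange equation on `(a, b)` with zero boundary values and volume
`V`; here `κ cos α = k²` and `κ sin α = k² D`. -/
noncomputable def dropProfile (k D V a b x : ℝ) : ℝ :=
  V * k / (2 * (k * (b - a) / 2 * Real.cosh (k * (b - a) / 2) - Real.sinh (k * (b - a) / 2))) *
      (Real.cosh (k * (b - a) / 2) - Real.cosh (k * (x - (a + b) / 2)))
    + D * (x - (a + b) / 2 -
      (b - a) / 2 * Real.sinh (k * (x - (a + b) / 2)) / Real.sinh (k * (b - a) / 2))

/-- The derivative of `dropProfile`. -/
noncomputable def dropSlope (k D V a b x : ℝ) : ℝ :=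
  V * k / (2 * (k * (b - a) / 2 * Real.cosh (k * (b - a) / 2) - Real.sinh (k * (b - a) / 2))) *
      (-(k * Real.sinh (k * (x - (a + b) / 2))))
    + D * (1 - (b - a) / 2 * (k * Real.cosh (k * (x - (a + b) / 2))) / Real.sinh (k * (b - a) / 2))

/-- The Lagrange multiplier of the volume constraint. -/
noncomputable def dropMultiplier (k D V a b : ℝ) : ℝ :=
  V * k / (2 * (k * (b - a) / 2 * Real.cosh (k * (b - a) / 2) - Real.sinh (k * (b - a) / 2))) *
      Real.cosh (k * (b - a) / 2) * k ^ 2 - k ^ 2 * D * ((a + b) / 2)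

section Profile

variable {k D V a b : ℝ}

theorem hasDerivAt_dropProfile (k D V a b x : ℝ) :
    HasDerivAt (dropProfile k D V a b) (dropSlope k D V a b x) x := by
  have h1 : HasDerivAt (fun x => k * (x - (a + b) / 2)) k x := by
    simpa using ((hasDerivAt_id' x).sub_const ((a + b) / 2)).const_mul k
  have h2 := h1.cosh
  have h3 := h1.sinh
  have h4 := ((h2.const_sub (Real.cosh (k * (b - a) / 2))).const_mul (V * k / (2 * (k * (b - a) / 2
    * Real.cosh (k * (b - a) / 2) - Real.sinh (k * (b - a) / 2))))).fun_add
    ((((hasDerivAt_id' x).sub_const ((a + b) / 2)).fun_sub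
      ((h3.const_mul ((b - a) / 2)).div_const (Real.sinh (k * (b - a) / 2)))).const_mul D)
  refine h4.congr_deriv ?_
  unfold dropSlope
  ring

theorem hasDerivAt_dropSlope (k D V a b x : ℝ) :
    HasDerivAt (dropSlope k D V a b)
      (dropProfile k D V a b x * k ^ 2 - x * (k ^ 2 * D) - dropMultiplier k D V a b) x := by
  have h1 : HasDerivAt (fun x => k * (x - (a + b) / 2)) k x := by
    simpa using ((hasDerivAt_id' x).sub_const ((a + b) / 2)).const_mul k
  have h2 := h1.cosh
  have h3 := h1.sinh
  have h4 := (((h3.const_mul k).fun_neg).const_mul (V * k / (2 * (k * (b - a) / 2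
    * Real.cosh (k * (b - a) / 2) - Real.sinh (k * (b - a) / 2))))).fun_add
    (((((h2.const_mul k).const_mul ((b - a) / 2)).div_const
      (Real.sinh (k * (b - a) / 2))).const_sub 1).const_mul D)
  refine h4.congr_deriv ?_
  unfold dropProfile dropMultiplier
  ring

theorem dropProfile_left (hk : 0 < k) (hab : a < b) : dropProfile k D V a b a = 0 := by
  have hz : 0 < k * (b - a) / 2 := by have := sub_pos.2 hab; positivity
  have hs := (Real.sinh_pos_iff.2 hz).ne'
  unfold dropProfile
  rw [show k * (a - (a + b) / 2) = -(k * (b - a) / 2) by ring, Real.cosh_neg, Real.sinh_neg]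
  field_simp
  ring

theorem dropProfile_right (hk : 0 < k) (hab : a < b) : dropProfile k D V a b b = 0 := by
  have hz : 0 < k * (b - a) / 2 := by have := sub_pos.2 hab; positivity
  have hs := (Real.sinh_pos_iff.2 hz).ne'
  unfold dropProfile
  rw [show k * (b - (a + b) / 2) = k * (b - a) / 2 by ring]
  field_simp
  ring

theorem dropSlope_left (hk : 0 < k) (hab : a < b) :
    dropSlope k D V a b a = V * k ^ 2 / 2 / cothGap (k * (b - a) / 2)
      - D * cothGap (k * (b - a) / 2) := by
  have hz : 0 < k * (b - a) / 2 := by have := sub_pos.2 hab; positivity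
  have hs := (Real.sinh_pos_iff.2 hz).ne'
  have hg := (sub_pos.2 (sinh_lt_mul_cosh hz)).ne'
  rw [cothGap_eq hz]
  unfold dropSlope
  rw [show k * (a - (a + b) / 2) = -(k * (b - a) / 2) by ring, Real.cosh_neg, Real.sinh_neg]
  obtain ⟨z, hzz⟩ : ∃ z, z = k * (b - a) / 2 := ⟨_, rfl⟩
  rw [show (b - a) / 2 * (k * Real.cosh (k * (b - a) / 2))
    = k * (b - a) / 2 * Real.cosh (k * (b - a) / 2) by ring]
  rw [← hzz] at hs hg ⊢
  field_simp
  ring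

theorem dropSlope_right (hk : 0 < k) (hab : a < b) :
    dropSlope k D V a b b = -(V * k ^ 2 / 2 / cothGap (k * (b - a) / 2)
      + D * cothGap (k * (b - a) / 2)) := by
  have hz : 0 < k * (b - a) / 2 := by have := sub_pos.2 hab; positivity
  have hs := (Real.sinh_pos_iff.2 hz).ne'
  have hg := (sub_pos.2 (sinh_lt_mul_cosh hz)).ne'
  rw [cothGap_eq hz]
  unfold dropSlope
  rw [show k * (b - (a + b) / 2) = k * (b - a) / 2 by ring]
  obtain ⟨z, hzz⟩ : ∃ z, z = k * (b - a) / 2 := ⟨_, rfl⟩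
  rw [show (b - a) / 2 * (k * Real.cosh (k * (b - a) / 2))
    = k * (b - a) / 2 * Real.cosh (k * (b - a) / 2) by ring]
  rw [← hzz] at hs hg ⊢
  field_simp
  ring

theorem integral_dropProfile (hk : 0 < k) (hab : a < b) :
    ∫ x in a..b, dropProfile k D V a b x = V := by
  have hz : 0 < k * (b - a) / 2 := by have := sub_pos.2 hab; positivity
  have hs := (Real.sinh_pos_iff.2 hz).ne'
  have hg := (sub_pos.2 (sinh_lt_mul_cosh hz)).ne'
  have hd : ∀ x ∈ uIcc a b, HasDerivAt (fun x => V * k / (2 * (k * (b - a) / 2 *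
      Real.cosh (k * (b - a) / 2) - Real.sinh (k * (b - a) / 2))) *
      (x * Real.cosh (k * (b - a) / 2) - Real.sinh (k * (x - (a + b) / 2)) / k)
      + D * ((x - (a + b) / 2) ^ 2 / 2 - (b - a) / 2 * (Real.cosh (k * (x - (a + b) / 2)) / k)
        / Real.sinh (k * (b - a) / 2))) (dropProfile k D V a b x) x := by
    intro x _
    have h0 := (hasDerivAt_id' x).sub_const ((a + b) / 2)
    have h1 : HasDerivAt (fun x => k * (x - (a + b) / 2)) k x := by
      simpa using h0.const_mul k
    have h4 := ((((hasDerivAt_id' x).mul_const (Real.cosh (k * (b - a) / 2))).fun_sub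
      (h1.sinh.div_const k)).const_mul (V * k / (2 * (k * (b - a) / 2
        * Real.cosh (k * (b - a) / 2) - Real.sinh (k * (b - a) / 2))))).fun_add
      ((((h0.fun_pow 2).div_const 2).fun_sub
        (((h1.cosh.div_const k).const_mul ((b - a) / 2)).div_const
          (Real.sinh (k * (b - a) / 2)))).const_mul D)
    refine h4.congr_deriv ?_
    unfold dropProfile
    rw [mul_div_cancel_right₀ _ hk.ne', mul_div_cancel_right₀ _ hk.ne']
    push_cast
    ring
  rw [intervalIntegral.integral_eq_sub_of_hasDerivAt hd (Continuous.intervalIntegrable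
    (continuous_iff_continuousAt.2 fun x => (hasDerivAt_dropProfile k D V a b x).continuousAt) _ _)]
  rw [show k * (a - (a + b) / 2) = -(k * (b - a) / 2) by ring, Real.cosh_neg, Real.sinh_neg,
    show k * (b - (a + b) / 2) = k * (b - a) / 2 by ring]
  obtain ⟨z, hzz⟩ : ∃ z, z = k * (b - a) / 2 := ⟨_, rfl⟩
  have hb : b = a + 2 * z / k := by
    rw [hzz]
    field_simp
    ring
  rw [← hzz] at hs hg ⊢
  rw [hb]
  field_simp
  ring

/-- A function with zero boundary values and nonnegative initial slope which is first strictly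
convex and then strictly concave is positive. -/
theorem pos_of_convex_concave {f f' f'' : ℝ → ℝ} (hf : ∀ x, HasDerivAt f (f' x) x)
    (hf' : ∀ x, HasDerivAt f' (f'' x) x) (ha : f a = 0) (hb : f b = 0) (ha' : 0 ≤ f' a) {y : ℝ}
    (h₁ : ∀ x ∈ Ioo a b, x < y → 0 < f'' x) (h₂ : ∀ x ∈ Ioo a b, y < x → f'' x < 0) :
    ∀ x ∈ Ioo a b, 0 < f x := by
  have hleft : ∀ x ∈ Ioo a b, x ≤ y → 0 < f x := by
    intro x hx hxy
    have hm' : StrictMonoOn f' (Icc a x) := by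
      refine strictMonoOn_of_deriv_pos (convex_Icc a x)
        (fun s _ => (hf' s).continuousAt.continuousWithinAt) fun s hs => ?_
      rw [interior_Icc] at hs
      rw [(hf' s).deriv]
      exact h₁ s ⟨hs.1, hs.2.trans hx.2⟩ (hs.2.trans_le hxy)
    have hm : StrictMonoOn f (Icc a x) := by
      refine strictMonoOn_of_deriv_pos (convex_Icc a x)
        (fun s _ => (hf s).continuousAt.continuousWithinAt) fun s hs => ?_
      rw [interior_Icc] at hs
      rw [(hf s).deriv]
      exact ha'.trans_lt (hm' ⟨le_rfl, hx.1.le⟩ ⟨hs.1.le, hs.2.le⟩ hs.1)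
    exact ha ▸ hm ⟨le_rfl, hx.1.le⟩ ⟨hx.1.le, le_rfl⟩ hx.1
  intro x hx
  rcases le_or_gt x y with hxy | hxy
  · exact hleft x hx hxy
  · have hc : max a y < x := max_lt hx.1 hxy
    have hfc : 0 ≤ f (max a y) := by
      rcases le_or_gt y a with h | h
      · rw [max_eq_left h, ha]
      · rw [max_eq_right h.le]
        exact (hleft y ⟨h, hxy.trans hx.2⟩ le_rfl).le
    have hconc : StrictConcaveOn ℝ (Icc (max a y) b) f := by
      refine strictConcaveOn_of_deriv2_neg (convex_Icc _ _)
        (fun s _ => (hf s).continuousAt.continuousWithinAt) fun s hs => ?_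
      rw [interior_Icc] at hs
      have e1 : deriv f = f' := funext fun s => (hf s).deriv
      have e2 : deriv f' = f'' := funext fun s => (hf' s).deriv
      simp only [Function.iterate_succ, Function.iterate_zero, Function.comp, id, e1, e2]
      exact h₂ s ⟨(le_max_left _ _).trans_lt hs.1, hs.2⟩ ((le_max_right _ _).trans_lt hs.1)
    have := hconc.lt_on_openSegment (left_mem_Icc.2 (hc.trans hx.2).le)
      (right_mem_Icc.2 (hc.trans hx.2).le) (hc.trans hx.2).ne
      (z := x) (by rw [openSegment_eq_Ioo (hc.trans hx.2)]; exact ⟨hc, hx.2⟩)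
    rw [hb, min_eq_right hfc] at this
    exact this

theorem exists_sign_change {p q : ℝ} (hp : 0 < p) (hq : 0 < q) :
    (∀ t, 0 < p * Real.cosh t + q * Real.sinh t) ∨
      ∃ t₀, (∀ t < t₀, p * Real.cosh t + q * Real.sinh t < 0) ∧
        ∀ t > t₀, 0 < p * Real.cosh t + q * Real.sinh t := by
  have key : ∀ t, p * Real.cosh t + q * Real.sinh t
      = ((p + q) * Real.exp (2 * t) - (q - p)) * Real.exp (-t) / 2 := fun t => by
    have h1 : Real.exp (2 * t) * Real.exp (-t) = Real.exp t := by
      rw [← Real.exp_add]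
      congr 1
      ring
    rw [Real.cosh_eq, Real.sinh_eq, sub_mul, mul_assoc, h1]
    ring
  rcases le_or_gt q p with h | h
  · refine Or.inl fun t => ?_
    rw [key]
    have := Real.exp_pos (2 * t)
    have := Real.exp_pos (-t)
    have : 0 < (p + q) * Real.exp (2 * t) - (q - p) := by
      have : 0 < (p + q) * Real.exp (2 * t) := by positivity
      linarith
    positivity
  · have hr : 0 < (q - p) / (p + q) := div_pos (by linarith) (by linarith)
    refine Or.inr ⟨Real.log ((q - p) / (p + q)) / 2, fun t ht => ?_, fun t ht => ?_⟩
    · have h1 : Real.exp (2 * t) < (q - p) / (p + q) :=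
        (Real.lt_log_iff_exp_lt hr).1 (by linarith)
      rw [lt_div_iff₀ (by linarith)] at h1
      rw [key]
      have := mul_neg_of_neg_of_pos (show (p + q) * Real.exp (2 * t) - (q - p) < 0 by linarith)
        (Real.exp_pos (-t))
      linarith
    · have h1 : (q - p) / (p + q) < Real.exp (2 * t) :=
        (Real.log_lt_iff_lt_exp hr).1 (by linarith)
      rw [div_lt_iff₀ (by linarith)] at h1
      rw [key]
      have := mul_pos (show 0 < (p + q) * Real.exp (2 * t) - (q - p) by linarith)
        (Real.exp_pos (-t))
      linarith

theorem dropProfile_pos (hk : 0 < k) (hD : 0 < D) (hV : 0 < V) (hab : a < b)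
    (hslope : 0 ≤ dropSlope k D V a b a) : ∀ x ∈ Ioo a b, 0 < dropProfile k D V a b x := by
  have hba := sub_pos.2 hab
  have hz : 0 < k * (b - a) / 2 := by positivity
  have hs := Real.sinh_pos_iff.2 hz
  have hg := sub_pos.2 (sinh_lt_mul_cosh hz)
  set p := V * k / (2 * (k * (b - a) / 2 * Real.cosh (k * (b - a) / 2)
    - Real.sinh (k * (b - a) / 2))) with hp
  set q := D * ((b - a) / 2) / Real.sinh (k * (b - a) / 2) with hq
  have hp0 : 0 < p := by positivity
  have hq0 : 0 < q := by positivity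
  have hsec : ∀ x, dropProfile k D V a b x * k ^ 2 - x * (k ^ 2 * D) - dropMultiplier k D V a b
      = -(k ^ 2 * (p * Real.cosh (k * (x - (a + b) / 2))
        + q * Real.sinh (k * (x - (a + b) / 2)))) := fun x => by
    unfold dropProfile dropMultiplier
    rw [← hp, hq]
    ring
  have hk2 : 0 < k ^ 2 := by positivity
  rcases exists_sign_change hp0 hq0 with h | ⟨t₀, h₁, h₂⟩
  · refine pos_of_convex_concave (hasDerivAt_dropProfile k D V a b) (hasDerivAt_dropSlope k D V a b)
      (dropProfile_left hk hab) (dropProfile_right hk hab) hslope (y := a)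
      (fun x hx hxa => absurd hx.1 (not_lt.2 hxa.le)) fun x _ _ => ?_
    rw [hsec]
    exact neg_neg_of_pos (mul_pos hk2 (h _))
  · refine pos_of_convex_concave (hasDerivAt_dropProfile k D V a b) (hasDerivAt_dropSlope k D V a b)
      (dropProfile_left hk hab) (dropProfile_right hk hab) hslope (y := (a + b) / 2 + t₀ / k)
      (fun x _ hx => ?_) fun x _ hx => ?_
    · rw [hsec]
      refine neg_pos_of_neg (mul_neg_of_pos_of_neg hk2 (h₁ _ ?_))
      have : (x - (a + b) / 2) < t₀ / k := by linarith
      rw [lt_div_iff₀ hk] at this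
      linarith
    · rw [hsec]
      refine neg_neg_of_pos (mul_pos hk2 (h₂ _ ?_))
      have : t₀ / k < (x - (a + b) / 2) := by linarith
      rw [div_lt_iff₀ hk] at this
      linarith

/-- Where the profile leaves zero tangentially, the obstacle exerts an upward reaction. -/
theorem dropMultiplier_add_le (hk : 0 < k) (hD : 0 < D) (hab : a < b)
    (hslope : dropSlope k D V a b a = 0) :
    a * (k ^ 2 * D) + dropMultiplier k D V a b ≤ 0 := by
  have hba := sub_pos.2 hab
  have hz : 0 < k * (b - a) / 2 := by positivity
  have hs := Real.sinh_pos_iff.2 hz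
  have hg := sub_pos.2 (sinh_lt_mul_cosh hz)
  have h1 := lt_sinh_mul_cosh hz
  have h2 := Real.cosh_sq (k * (b - a) / 2)
  have h3 := Real.cosh_pos (k * (b - a) / 2)
  unfold dropSlope at hslope
  rw [show k * (a - (a + b) / 2) = -(k * (b - a) / 2) by ring, Real.cosh_neg, Real.sinh_neg]
    at hslope
  unfold dropMultiplier
  obtain ⟨p, hp⟩ : ∃ p, p = V * k / (2 * (k * (b - a) / 2 * Real.cosh (k * (b - a) / 2)
    - Real.sinh (k * (b - a) / 2))) := ⟨_, rfl⟩
  rw [← hp] at hslope ⊢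
  obtain ⟨z, hzz⟩ : ∃ z, z = k * (b - a) / 2 := ⟨_, rfl⟩
  have hb : (b - a) / 2 = z / k := by rw [hzz]; field_simp
  rw [hb] at hslope
  rw [← hzz] at hs hg h1 h2 h3 hslope ⊢
  have h4 : p * k * Real.sinh z ^ 2 = D * (z * Real.cosh z - Real.sinh z) := by
    field_simp at hslope
    linarith
  have h5 : a * (k ^ 2 * D) + (p * Real.cosh z * k ^ 2 - k ^ 2 * D * ((a + b) / 2))
      = k * (p * k * Real.cosh z - D * z) := by
    have h6 : (a + b) / 2 = a + z / k := by rw [← hb]; ring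
    rw [h6]
    field_simp
    ring
  rw [h5]
  refine mul_nonpos_of_nonneg_of_nonpos hk.le ?_
  have h7 : (p * k * Real.cosh z - D * z) * Real.sinh z ^ 2
      = D * (z - Real.sinh z * Real.cosh z) := by
    linear_combination Real.cosh z * h4 + D * z * h2
  have h8 : (p * k * Real.cosh z - D * z) * Real.sinh z ^ 2 ≤ 0 := by
    rw [h7]
    exact mul_nonpos_of_nonneg_of_nonpos hD.le (by linarith)
  by_contra! h9
  have := mul_pos h9 (pow_pos hs 2)
  linarith

end Profile

/-! ### Classification of the obstacle minimizers -/

/-- The drop on `(a, b)`, extended by zero. -/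
noncomputable def dropShape (k D V a b : ℝ) : ℝ → ℝ := extendZero a b (dropProfile k D V a b)

section Classification

variable {k D V L a b : ℝ}

theorem derivWithin_dropShape (hk : 0 < k) (hab : a < b) {x : ℝ} (hx : x ∈ Icc a b) :
    derivWithin (dropShape k D V a b) (Icc a b) x = dropSlope k D V a b x := by
  have h : ∀ y ∈ Icc a b, dropShape k D V a b y = dropProfile k D V a b y := fun y hy =>
    extendZero_of_mem_Icc (dropProfile_left hk hab) (dropProfile_right hk hab) hy
  rw [derivWithin_congr h (h x hx)]
  exact (hasDerivAt_dropProfile k D V a b x).hasDerivWithinAt.derivWithin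
    (uniqueDiffOn_Icc hab x hx)

theorem dropSlope_left_pos (hk : 0 < k) (hD : 0 < D) (hL : 0 < L)
    (hLeq : cothGap (k * L / 2) ^ 2 = V * k ^ 2 / 2 / D) (hab : a < b) (hlt : b - a < L) :
    0 < dropSlope k D V a b a := by
  have hba := sub_pos.2 hab
  have hz : 0 < k * (b - a) / 2 := by positivity
  have hg := cothGap_pos hz
  have h1 : cothGap (k * (b - a) / 2) < cothGap (k * L / 2) :=
    strictMonoOn_cothGap hz (show 0 < k * L / 2 by positivity) (by
      have := mul_lt_mul_of_pos_left hlt hk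
      linarith)
  have h2 := pow_lt_pow_left₀ h1 hg.le two_ne_zero
  rw [hLeq, lt_div_iff₀ hD] at h2
  rw [dropSlope_left hk hab, sub_pos, lt_div_iff₀ hg]
  linarith

theorem dropSlope_left_eq_zero (hk : 0 < k) (hD : 0 < D) (hL : 0 < L)
    (hLeq : cothGap (k * L / 2) ^ 2 = V * k ^ 2 / 2 / D) (heq : b - a = L) :
    dropSlope k D V a b a = 0 := by
  have hab : a < b := by linarith
  have hg := cothGap_pos (show 0 < k * L / 2 by positivity)
  rw [eq_div_iff hD.ne'] at hLeq
  rw [dropSlope_left hk hab, heq, sub_eq_zero, div_eq_iff hg.ne']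
  linarith

theorem dropSlope_right_neg (hk : 0 < k) (hD : 0 < D) (hV : 0 < V) (hab : a < b) :
    dropSlope k D V a b b < 0 := by
  have hba := sub_pos.2 hab
  have hg := cothGap_pos (show 0 < k * (b - a) / 2 by positivity)
  rw [dropSlope_right hk hab]
  exact neg_neg_of_pos (by positivity)

theorem dropSlope_left_nonneg (hk : 0 < k) (hD : 0 < D) (hL : 0 < L)
    (hLeq : cothGap (k * L / 2) ^ 2 = V * k ^ 2 / 2 / D) (hab : a < b) (hle : b - a ≤ L) :
    0 ≤ dropSlope k D V a b a := by
  rcases hle.lt_or_eq with h | h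
  · exact (dropSlope_left_pos hk hD hL hLeq hab h).le
  · exact (dropSlope_left_eq_zero hk hD hL hLeq h).ge

theorem half_dropSlope_left_sq (hk : 0 < k) (hab : a < b) :
    1 / 2 * |dropSlope k D V a b a| ^ 2
      = spreadingLaw k (V * k ^ 2 / 2) D (b - a) / 2 - V * k ^ 2 / 2 * D := by
  have hba := sub_pos.2 hab
  have hg := (cothGap_pos (show 0 < k * (b - a) / 2 by positivity)).ne'
  rw [sq_abs, dropSlope_left hk hab, spreadingLaw]
  field_simp
  ring

theorem half_dropSlope_right_sq (hk : 0 < k) (hab : a < b) :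
    1 / 2 * |dropSlope k D V a b b| ^ 2
      = spreadingLaw k (V * k ^ 2 / 2) D (b - a) / 2 + V * k ^ 2 / 2 * D := by
  have hba := sub_pos.2 hab
  have hg := (cothGap_pos (show 0 < k * (b - a) / 2 by positivity)).ne'
  rw [sq_abs, dropSlope_right hk hab, spreadingLaw]
  field_simp
  ring

variable {κ α : ℝ}

/-- On an interval of more than the maximal length the drop covers only a terminal interval of
maximal length. -/
theorem isObstacleMinimizer_iff_dropShape (hk : 0 < k) (hD : 0 < D) (hV : 0 < V)
    (hc : κ * Real.cos α = k ^ 2) (hs : κ * Real.sin α = k ^ 2 * D) (hL : 0 < L)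
    (hLeq : cothGap (k * L / 2) ^ 2 = V * k ^ 2 / 2 / D) (hab : a < b) (u : ℝ → ℝ) :
    IsObstacleMinimizer κ α V a b u ↔ u = dropShape k D V (max a (b - L)) b := by
  have hab' : max a (b - L) < b := max_lt hab (by linarith)
  have hle : b - max a (b - L) ≤ L := by linarith [le_max_right a (b - L)]
  have hslope := dropSlope_left_nonneg hk hD hL hLeq hab' hle
  refine isObstacleMinimizer_iff (p := dropProfile k D V (max a (b - L)) b)
    (p' := dropSlope k D V (max a (b - L)) b) (lam := dropMultiplier k D V (max a (b - L)) b)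
    (by rw [hc]; positivity) (by rw [hs]; positivity) (le_max_left _ _) hab'.le
    (hasDerivAt_dropProfile k D V _ b) (fun x => ?_) (dropProfile_left hk hab')
    (dropProfile_right hk hab') (fun h => ?_) (fun x hx => ?_) (integral_dropProfile hk hab') u
  · rw [hc, hs]
    exact hasDerivAt_dropSlope k D V _ b x
  · have h1 : max a (b - L) = b - L := by
      rcases max_choice a (b - L) with h2 | h2
      · exact absurd h2 h.ne'
      · exact h2
    have h2 := dropSlope_left_eq_zero (V := V) (a := max a (b - L)) (b := b) hk hD hL hLeq
      (by rw [h1]; ring)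
    refine ⟨h2, ?_⟩
    rw [hs]
    exact dropMultiplier_add_le hk hD hab' h2
  · exact (dropProfile_pos hk hD hV hab' hslope x hx).le

theorem isObstacleMinimizer_iff_of_le (hk : 0 < k) (hD : 0 < D) (hV : 0 < V)
    (hc : κ * Real.cos α = k ^ 2) (hs : κ * Real.sin α = k ^ 2 * D) (hL : 0 < L)
    (hLeq : cothGap (k * L / 2) ^ 2 = V * k ^ 2 / 2 / D) (hab : b - a ∈ Ioc 0 L) (u : ℝ → ℝ) :
    IsObstacleMinimizer κ α V a b u ↔ u = dropShape k D V a b := by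
  have := isObstacleMinimizer_iff_dropShape hk hD hV hc hs hL hLeq (sub_pos.1 hab.1) u
  rwa [max_eq_left (by linarith [hab.2])] at this

theorem setOf_dropShape_pos (hk : 0 < k) (hD : 0 < D) (hV : 0 < V) (hL : 0 < L)
    (hLeq : cothGap (k * L / 2) ^ 2 = V * k ^ 2 / 2 / D) (hab : b - a ∈ Ioc 0 L) :
    {x | 0 < dropShape k D V a b x} = Ioo a b := by
  have hslope := dropSlope_left_nonneg hk hD hL hLeq (sub_pos.1 hab.1) hab.2
  ext x
  constructor
  · intro hx
    by_contra hn
    have h0 : dropShape k D V a b x = 0 := indicator_of_notMem hn _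
    exact absurd hx (by simp [h0])
  · intro hx
    have h1 := dropProfile_pos hk hD hV (sub_pos.1 hab.1) hslope x hx
    have h2 : dropShape k D V a b x = dropProfile k D V a b x := indicator_of_mem hx _
    exact h1.trans_eq h2.symm

/-- An obstacle minimizer that is positive on all of `(a, b)` exists only if the length of the
interval does not exceed the maximal length. -/
theorem IsObstacleMinimizer.length_mem (hk : 0 < k) (hD : 0 < D) (hV : 0 < V)
    (hc : κ * Real.cos α = k ^ 2) (hs : κ * Real.sin α = k ^ 2 * D) (hL : 0 < L)
    (hLeq : cothGap (k * L / 2) ^ 2 = V * k ^ 2 / 2 / D) {u : ℝ → ℝ}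
    (hu : IsObstacleMinimizer κ α V a b u) (hpos : {x | 0 < u x} = Ioo a b) :
    b - a ∈ Ioc 0 L := by
  have hab : a < b := by
    by_contra! h
    have h0 : u = 0 := by
      funext x
      exact hu.1.1.eq_zero x (by simp [Ioo_eq_empty_of_le h])
    have h1 := hu.1.2.2
    rw [h0] at h1
    simp at h1
    exact hV.ne h1
  refine ⟨sub_pos.2 hab, ?_⟩
  by_contra! hlt
  have h1 := (isObstacleMinimizer_iff_dropShape hk hD hV hc hs hL hLeq hab u).1 hu
  rw [max_eq_right (by linarith)] at h1
  have hx : (a + (b - L)) / 2 ∈ {x | 0 < u x} := by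
    rw [hpos]
    constructor <;> linarith
  have h2 : u ((a + (b - L)) / 2) = 0 := by
    rw [h1]
    exact indicator_of_notMem (fun h => absurd h.1 (by linarith)) _
  exact absurd hx (by simp [h2])

end Classification

/-! ### Sliding drops and the reduced dynamics -/

section Reduction

variable {κ α k D V L a₀ b₀ : ℝ} {β a b : ℝ → ℝ} {u : ℝ → ℝ → ℝ}

theorem IsSlidingDrop.length_mem (hk : 0 < k) (hD : 0 < D) (hV : 0 < V)
    (hc : κ * Real.cos α = k ^ 2) (hs : κ * Real.sin α = k ^ 2 * D) (hL : 0 < L)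
    (hLeq : cothGap (k * L / 2) ^ 2 = V * k ^ 2 / 2 / D)
    (h : IsSlidingDrop κ α V β a₀ b₀ a b u) {t : ℝ} (ht : 0 ≤ t) : b t - a t ∈ Ioc 0 L :=
  (h.minimizer t ht).length_mem hk hD hV hc hs hL hLeq (h.pos_set t ht)

theorem IsSlidingDrop.eq_dropShape (hk : 0 < k) (hD : 0 < D) (hV : 0 < V)
    (hc : κ * Real.cos α = k ^ 2) (hs : κ * Real.sin α = k ^ 2 * D) (hL : 0 < L)
    (hLeq : cothGap (k * L / 2) ^ 2 = V * k ^ 2 / 2 / D)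
    (h : IsSlidingDrop κ α V β a₀ b₀ a b u) {t : ℝ} (ht : 0 ≤ t) :
    (fun x => u x t) = dropShape k D V (a t) (b t) :=
  (isObstacleMinimizer_iff_of_le hk hD hV hc hs hL hLeq
    (h.length_mem hk hD hV hc hs hL hLeq ht) _).1 (h.minimizer t ht)

/-- The right endpoint and the length of a sliding drop follow the reduced dynamics. -/
theorem IsSlidingDrop.isDropFlow (hk : 0 < k) (hD : 0 < D) (hV : 0 < V)
    (hc : κ * Real.cos α = k ^ 2) (hs : κ * Real.sin α = k ^ 2 * D) (hL : 0 < L)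
    (hLeq : cothGap (k * L / 2) ^ 2 = V * k ^ 2 / 2 / D)
    (h : IsSlidingDrop κ α V β a₀ b₀ a b u) {T : ℝ} (hT : 0 ≤ T) :
    IsDropFlow (spreadingLaw k (V * k ^ 2 / 2) D) β (V * k ^ 2 / 2 * D) L b₀ (b₀ - a₀) T b
      (fun t => b t - a t) := by
  obtain ⟨K₁, h₁⟩ := h.lipschitz_left T
  obtain ⟨K₂, h₂⟩ := h.lipschitz_right T
  have hmem : ∀ t, 0 ≤ t → b t - a t ∈ Ioc 0 L := fun t ht =>
    h.length_mem hk hD hV hc hs hL hLeq ht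
  have hl := h.velocity_left
  have hr := h.velocity_right
  rw [ae_restrict_iff' measurableSet_Ici] at hl hr
  have hda := (h₁.absolutelyContinuousOnInterval_of_le hT).ae_differentiableAt_Ioo
  have hdb := (h₂.absolutelyContinuousOnInterval_of_le hT).ae_differentiableAt_Ioo
  have key : ∀ᵐ t, t ∈ Ioo 0 T → DifferentiableAt ℝ a t ∧ DifferentiableAt ℝ b t ∧
      deriv b t = spreadingLaw k (V * k ^ 2 / 2) D (b t - a t) / 2 + V * k ^ 2 / 2 * D - β (b t) ∧
      β (a t) ≤ deriv a t +
        (spreadingLaw k (V * k ^ 2 / 2) D (b t - a t) / 2 - V * k ^ 2 / 2 * D) ∧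
      (b t - a t < L → deriv a t +
        (spreadingLaw k (V * k ^ 2 / 2) D (b t - a t) / 2 - V * k ^ 2 / 2 * D) = β (a t)) := by
    filter_upwards [hl, hr, hda, hdb] with t hl hr hda hdb ht
    have ht0 : t ∈ Ici (0 : ℝ) := mem_Ici.2 ht.1.le
    have hab : a t < b t := sub_pos.1 (hmem t ht0).1
    have hl := hl ht0
    have hr := hr ht0
    rw [h.eq_dropShape hk hD hV hc hs hL hLeq ht0] at hl hr
    rw [derivWithin_dropShape hk hab (left_mem_Icc.2 hab.le), half_dropSlope_left_sq hk hab] at hl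
    rw [derivWithin_dropShape hk hab (right_mem_Icc.2 hab.le), half_dropSlope_right_sq hk hab]
      at hr
    refine ⟨hda ht, hdb ht, ?_, ?_, fun hlt => ?_⟩
    · have h3 := abs_pos.2 (dropSlope_right_neg hk hD hV hab).ne
      rcases min_choice (-deriv b t + (spreadingLaw k (V * k ^ 2 / 2) D (b t - a t) / 2
        + V * k ^ 2 / 2 * D) - β (b t)) |dropSlope k D V (a t) (b t) (b t)| with h4 | h4
      · rw [h4] at hr
        linarith
      · rw [h4] at hr
        exact absurd hr h3.ne'
    · have h3 := min_le_left (deriv a t + (spreadingLaw k (V * k ^ 2 / 2) D (b t - a t) / 2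
        - V * k ^ 2 / 2 * D) - β (a t)) |dropSlope k D V (a t) (b t) (a t)|
      linarith
    · have h3 := abs_pos.2 (dropSlope_left_pos hk hD hL hLeq hab hlt).ne'
      rcases min_choice (deriv a t + (spreadingLaw k (V * k ^ 2 / 2) D (b t - a t) / 2
        - V * k ^ 2 / 2 * D) - β (a t)) |dropSlope k D V (a t) (b t) (a t)| with h4 | h4
      · rw [h4] at hl
        linarith
      · rw [h4] at hl
        exact absurd hl h3.ne'
  refine ⟨⟨K₂, h₂⟩, ⟨_, h₂.sub h₁⟩, h.right_zero, ?_, fun t ht => hmem t ht.1, ?_, ?_, ?_⟩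
  · rw [h.left_zero, h.right_zero]
  · filter_upwards [key] with t h3 ht
    exact (h3 ht).2.2.1
  · filter_upwards [key] with t h3 ht
    obtain ⟨da, db, e1, e2, -⟩ := h3 ht
    rw [deriv_fun_sub db da, e1, sub_sub_cancel]
    linarith
  · filter_upwards [key] with t h3 ht hlt
    obtain ⟨da, db, e1, -, e2⟩ := h3 ht
    rw [deriv_fun_sub db da, e1, sub_sub_cancel]
    linarith [e2 hlt]

/-- Conversely, the reduced dynamics produces a sliding drop. -/
theorem isSlidingDrop_of_isDropFlow (hk : 0 < k) (hD : 0 < D) (hV : 0 < V)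
    (hc : κ * Real.cos α = k ^ 2) (hs : κ * Real.sin α = k ^ 2 * D) (hL : 0 < L)
    (hLeq : cothGap (k * L / 2) ^ 2 = V * k ^ 2 / 2 / D) {l : ℝ → ℝ}
    (h : ∀ T, 0 ≤ T → IsDropFlow (spreadingLaw k (V * k ^ 2 / 2) D) β (V * k ^ 2 / 2 * D) L b₀
      (b₀ - a₀) T b l) :
    IsSlidingDrop κ α V β a₀ b₀ (fun t => b t - l t) b
      (fun x t => dropShape k D V (b t - l t) (b t) x) := by
  have hmem : ∀ t, 0 ≤ t → b t - (b t - l t) ∈ Ioc 0 L := fun t ht => by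
    rw [sub_sub_cancel]
    exact (h t ht).mem t ⟨ht, le_rfl⟩
  have hext : ∀ T : ℝ, Icc 0 T ⊆ Icc 0 (max T 0) := fun T => Icc_subset_Icc_right (le_max_left _ _)
  have hreg : ∀ᵐ t, t ∈ Ici (0 : ℝ) → 0 < t ∧ ∃ T, t ∈ Ioo 0 T ∧
      DifferentiableAt ℝ b t ∧ DifferentiableAt ℝ l t ∧
      deriv b t = spreadingLaw k (V * k ^ 2 / 2) D (l t) / 2 + V * k ^ 2 / 2 * D - β (b t) ∧
      ((l t < L ∧ deriv l t =
        spreadingLaw k (V * k ^ 2 / 2) D (l t) - β (b t) - β (b t - l t)) ∨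
        (l t = L ∧ deriv l t = 0 ∧
          0 ≤ spreadingLaw k (V * k ^ 2 / 2) D (l t) - β (b t) - β (b t - l t))) := by
    have h1 : ∀ᵐ t, ∀ n : ℕ, t ∈ Ioo 0 (n : ℝ) → _ :=
      ae_all_iff.2 fun n : ℕ => (h n (Nat.cast_nonneg n)).ae_regime
    have h2 : ∀ᵐ t : ℝ, t ≠ 0 := by simp [ae_iff]
    filter_upwards [h1, h2] with t h1 h2 ht
    have ht0 : 0 < t := lt_of_le_of_ne ht (Ne.symm h2)
    obtain ⟨n, hn⟩ := exists_nat_gt t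
    exact ⟨ht0, n, ⟨ht0, hn⟩, h1 n ⟨ht0, hn⟩⟩
  constructor
  · intro T
    obtain ⟨K₁, h₁⟩ := (h _ (le_max_right T 0)).lipschitz_b
    obtain ⟨K₂, h₂⟩ := (h _ (le_max_right T 0)).lipschitz_l
    exact ⟨_, (h₁.sub h₂).mono (hext T)⟩
  · intro T
    obtain ⟨K₁, h₁⟩ := (h _ (le_max_right T 0)).lipschitz_b
    exact ⟨_, h₁.mono (hext T)⟩
  · simp only [(h 0 le_rfl).b_zero, (h 0 le_rfl).l_zero, sub_sub_cancel]
  · exact (h 0 le_rfl).b_zero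
  · exact fun t ht => setOf_dropShape_pos hk hD hV hL hLeq (hmem t ht)
  · exact fun t ht => (isObstacleMinimizer_iff_of_le hk hD hV hc hs hL hLeq (hmem t ht) _).2 rfl
  · rw [ae_restrict_iff' measurableSet_Ici]
    filter_upwards [hreg] with t hreg ht
    obtain ⟨-, -, -, db, dl, e1, e2⟩ := hreg ht
    have hab : b t - l t < b t := sub_pos.1 (hmem t ht).1
    change min (_ + 1 / 2 * |derivWithin (dropShape k D V (b t - l t) (b t)) _ _| ^ 2 - _)
      |derivWithin (dropShape k D V (b t - l t) (b t)) _ _| = 0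
    rw [derivWithin_dropShape hk hab (left_mem_Icc.2 hab.le), half_dropSlope_left_sq hk hab,
      deriv_fun_sub db dl, e1, sub_sub_cancel]
    rcases e2 with ⟨-, e3⟩ | ⟨e3, e4, e5⟩
    · rw [e3]
      refine (congrArg (min · _) ?_).trans (min_eq_left (abs_nonneg _))
      ring
    · rw [e4, dropSlope_left_eq_zero hk hD hL hLeq (by rw [sub_sub_cancel, e3]), abs_zero]
      refine min_eq_right ?_
      linarith
  · rw [ae_restrict_iff' measurableSet_Ici]
    filter_upwards [hreg] with t hreg ht
    obtain ⟨-, -, -, db, dl, e1, -⟩ := hreg ht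
    have hab : b t - l t < b t := sub_pos.1 (hmem t ht).1
    change min (_ + 1 / 2 * |derivWithin (dropShape k D V (b t - l t) (b t)) _ _| ^ 2 - _)
      |derivWithin (dropShape k D V (b t - l t) (b t)) _ _| = 0
    rw [derivWithin_dropShape hk hab (right_mem_Icc.2 hab.le), half_dropSlope_right_sq hk hab, e1,
      sub_sub_cancel]
    refine (congrArg (min · _) ?_).trans (min_eq_left (abs_nonneg _))
    ring

end Reduction

theorem theorem2p2 (κ α V₀ : ℝ) (hκ : 0 < κ) (hα : 0 < α) (hα' : α < Real.pi / 2) (hV₀ : 0 < V₀)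
    (β : ℝ → ℝ) (hβ : ∃ K, LipschitzWith K β)
    (a₀ b₀ : ℝ) (u₀ : ℝ → ℝ) (hu₀ : IsInitialDrop κ α V₀ a₀ b₀ u₀) :
    ∃ (a b : ℝ → ℝ) (u : ℝ → ℝ → ℝ),
      IsSlidingDrop κ α V₀ β a₀ b₀ a b u ∧
      (∀ x, u x 0 = u₀ x) ∧
      (BddBelow (Set.range β) →
        ∃ K, LipschitzOnWith K a (Set.Ici 0) ∧ LipschitzOnWith K b (Set.Ici 0)) ∧
      ∀ (a' b' : ℝ → ℝ) (u' : ℝ → ℝ → ℝ), IsSlidingDrop κ α V₀ β a₀ b₀ a' b' u' →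
        ∀ t, 0 ≤ t → a' t = a t ∧ b' t = b t ∧ ∀ x, u' x t = u x t := by
  obtain ⟨K, hβ⟩ := hβ
  have hcos : 0 < Real.cos α := Real.cos_pos_of_mem_Ioo ⟨by linarith, hα'⟩
  have hsin : 0 < Real.sin α := Real.sin_pos_of_pos_of_lt_pi hα (by linarith [Real.pi_pos])
  -- `k = √(κ cos α)` and `D = tan α`
  obtain ⟨k, hk, hc⟩ : ∃ k > 0, κ * Real.cos α = k ^ 2 :=
    ⟨√(κ * Real.cos α), by positivity, (Real.sq_sqrt (by positivity)).symm⟩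
  obtain ⟨D, hD, hs⟩ : ∃ D > 0, κ * Real.sin α = k ^ 2 * D :=
    ⟨Real.sin α / Real.cos α, by positivity, by rw [← hc]; field_simp⟩
  -- the maximal length, at which the slope at the left endpoint vanishes
  obtain ⟨L, hL, hLeq⟩ : ∃ L > 0, cothGap (k * L / 2) ^ 2 = V₀ * k ^ 2 / 2 / D := by
    obtain ⟨z, hz, hze⟩ := exists_cothGap_eq (y := √(V₀ * k ^ 2 / 2 / D)) (by positivity)
    refine ⟨2 * z / k, by positivity, ?_⟩
    rw [show k * (2 * z / k) / 2 = z by field_simp, hze, Real.sq_sqrt (by positivity)]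
  have he : IsSpreadingLaw (spreadingLaw k (V₀ * k ^ 2 / 2) D) L :=
    isSpreadingLaw_spreadingLaw hk (by positivity) hD hL hLeq
  have hl₀ : b₀ - a₀ ∈ Ioc 0 L := hu₀.2.length_mem hk hD hV₀ hc hs hL hLeq hu₀.1
  obtain ⟨b, l, h⟩ := exists_isDropFlow_forall (γ := V₀ * k ^ 2 / 2 * D) (b₀ := b₀) he hβ hl₀
  refine ⟨fun t => b t - l t, b, fun x t => dropShape k D V₀ (b t - l t) (b t) x,
    isSlidingDrop_of_isDropFlow hk hD hV₀ hc hs hL hLeq h, fun x => ?_, ?_, ?_⟩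
  · change dropShape k D V₀ (b 0 - l 0) (b 0) x = u₀ x
    rw [(isObstacleMinimizer_iff_of_le hk hD hV₀ hc hs hL hLeq hl₀ u₀).1 hu₀.2,
      (h 0 le_rfl).b_zero, (h 0 le_rfl).l_zero, sub_sub_cancel]
  · rintro ⟨B, hB⟩
    exact IsDropFlow.exists_lipschitzOnWith_Ici he hβ (B₀ := -B)
      (fun x => by rw [neg_neg]; exact hB (mem_range_self x)) h
  · intro a' b' u' h' t ht
    obtain ⟨e1, e2⟩ := (h t ht).unique he hβ (h'.isDropFlow hk hD hV₀ hc hs hL hLeq ht) t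
      ⟨ht, le_rfl⟩
    have e3 : a' t = b t - l t := by linarith
    refine ⟨e3, e1, fun x => ?_⟩
    have e4 := congrFun (h'.eq_dropShape hk hD hV₀ hc hs hL hLeq ht) x
    rw [e3, e1] at e4
    exact e4
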